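/- Let $n\ge 1$ be an integer. Let $\Pi_n$ be the lattice of set partitions of $\{1,\dots,n\}$ ordered by refinement, and let $\bar\Pi_n=\Pi_n\setminus\{\hat 0,\hat 1\}$ be its proper part, with the action of $\mathfrak S_n$ induced by its action on $\{1,\dots,n\}$. Let $\tilde H_j(\bar\Pi_n)$ denote the reduced simplicial homology with complex coefficients of the order complex of $\bar\Pi_n$ (the simplicial complex of chains of $\bar\Pi_n$), where the empty poset $\bar\Pi_2$ has order complex $\{\emptyset\}$, so that $\tilde H_{-1}(\bar\Pi_2)=\mathbb C$, and where for $n=1$, when $\hat 0=\hat 1$, one uses the convention that $\tilde H_{-2}(\bar\Pi_1)=\mathbb C$ is the trivial module and the other homology is zero. Let $\mathfrak C_n$ be the cyclic subgroup of $\mathfrak S_n$ generated by $\sigma:=(1,2,\dots,n)$, let $e^{2\pi i/n}$ denote the one-dimensional complex representation of $\mathfrak C_n$ whose character value at $\sigma$ is $e^{2\pi i/n}$, and let $\mathrm{sgn}_n$ be the sign representation of $\mathfrak S_n$. Then $$\tilde H_{n-3}(\bar\Pi_n)\;\cong_{\mathfrak S_n}\; e^{2\pi i/n}\uparrow_{\mathfrak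 C_n}^{\mathfrak S_n}\otimes\,\mathrm{sgn}_n ,$$ where $\uparrow$ denotes induction; that is, the two sides are isomorphic as complex representations of $\mathfrak S_n$. -/

import Mathlib

/-! ## Reduced simplicial homology of the order complex of a poset, with group action -/

/-- The space of simplicial chains of the order complex of the poset `Q` that are spanned by the
faces with `k` elements (the faces of dimension `k - 1`): it has as basis the chains
`x₀ < x₁ < ⋯ < x_{k-1}` of `Q`.  For `k = 0` the only basis element is the empty chain. -/
abbrev OrderChains (Q : Type) [PartialOrder Q] (k : ℕ) : Type :=
  (Fin k ↪o Q) →₀ ℂ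

/-- The simplicial boundary map
`(x₀ < ⋯ < x_k) ↦ ∑ i, (-1) ^ i (x₀ < ⋯ < x_{i-1} < x_{i+1} < ⋯ < x_k)`.
For `k = 0` it is the augmentation. -/
noncomputable def orderBoundary (Q : Type) [PartialOrder Q] (k : ℕ) :
    OrderChains Q (k + 1) →ₗ[ℂ] OrderChains Q k :=
  Finsupp.linearCombination ℂ fun c : Fin (k + 1) ↪o Q =>
    ∑ i : Fin (k + 1), Finsupp.single ((Fin.succAboveOrderEmb i).trans c) ((-1 : ℂ) ^ (i : ℕ))

/-- The cycles of dimension `k - 1`; in dimension `-1` every chain is a cycle. -/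
noncomputable def orderCycles (Q : Type) [PartialOrder Q] : (k : ℕ) → Submodule ℂ (OrderChains Q k)
  | 0 => ⊤
  | k + 1 => LinearMap.ker (orderBoundary Q k)

/-- The boundaries of dimension `k - 1`. -/
noncomputable def orderBoundaries (Q : Type) [PartialOrder Q] (k : ℕ) :
    Submodule ℂ (OrderChains Q k) :=
  LinearMap.range (orderBoundary Q k)

/-- The boundary of a boundary is zero. -/
theorem orderBoundary_orderBoundary (Q : Type) [PartialOrder Q] (k : ℕ) :
    orderBoundary Q k ∘ₗ orderBoundary Q (k + 1) = 0 := by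
  ext c : 2
  simp only [LinearMap.comp_apply, Finsupp.lsingle_apply, orderBoundary,
    Finsupp.linearCombination_single, one_smul, map_sum, LinearMap.zero_apply, Finset.smul_sum,
    Finsupp.smul_single, smul_eq_mul]
  rw [← Finset.sum_product']
  rw [Finset.univ_product_univ]
  refine Finset.sum_ninvolution (fun p => (p.1.succAbove p.2, p.2.predAbove p.1)) ?_ ?_ ?_ ?_
  · rintro ⟨i, j⟩
    have h1 : (Fin.succAboveOrderEmb (j.predAbove i)).trans
        ((Fin.succAboveOrderEmb (i.succAbove j)).trans c) =
        (Fin.succAboveOrderEmb j).trans ((Fin.succAboveOrderEmb i).trans c) := by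
      ext x
      simp [Fin.succAbove_succAbove_succAbove_predAbove]
    have h2 : (-1 : ℂ) ^ ((i.succAbove j : Fin (k + 2)) : ℕ) *
        (-1) ^ ((j.predAbove i : Fin (k + 1)) : ℕ) = - ((-1) ^ (i : ℕ) * (-1) ^ (j : ℕ)) := by
      rw [← pow_add, ← pow_add]
      exact Fin.neg_one_pow_succAbove_add_predAbove i j
    simp only [h1, h2]
    rw [← Finsupp.single_add, add_neg_cancel, Finsupp.single_zero]
  · rintro ⟨i, j⟩ - h
    exact Fin.succAbove_ne i j (congrArg Prod.fst h)
  · intro p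
    exact Finset.mem_univ _
  · rintro ⟨i, j⟩
    exact Prod.ext (Fin.succAbove_succAbove_predAbove i j) (Fin.predAbove_predAbove_succAbove i j)

/-- The action of `G` on chains, given an action of `G` on `Q` by order automorphisms: `g` takes
`x₀ < ⋯ < x_{k-1}` to `g x₀ < ⋯ < g x_{k-1}`. -/
noncomputable def orderChainsRep {G : Type} [Group G] {Q : Type} [PartialOrder Q]
    (α : G →* (Q ≃o Q)) (k : ℕ) : Representation ℂ G (OrderChains Q k) where
  toFun g := Finsupp.lmapDomain ℂ ℂ fun c : Fin k ↪o Q => c.trans (α g).toOrderEmbedding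
  map_one' := by
    ext c : 2
    simp only [map_one, LinearMap.comp_apply, Finsupp.lsingle_apply, Finsupp.lmapDomain_apply,
      Finsupp.mapDomain_single, Module.End.one_apply]
    rfl
  map_mul' g h := by
    ext c : 2
    simp only [map_mul, LinearMap.comp_apply, Finsupp.lsingle_apply, Finsupp.lmapDomain_apply,
      Finsupp.mapDomain_single, Module.End.mul_apply]
    rfl

theorem orderBoundary_orderChainsRep {G : Type} [Group G] {Q : Type} [PartialOrder Q]
    (α : G →* (Q ≃o Q)) (k : ℕ) (g : G) (x : OrderChains Q (k + 1)) :
    orderBoundary Q k (orderChainsRep α (k + 1) g x) =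
      orderChainsRep α k g (orderBoundary Q k x) := by
  have h : orderBoundary Q k ∘ₗ orderChainsRep α (k + 1) g =
      orderChainsRep α k g ∘ₗ orderBoundary Q k := by
    ext c : 2
    simp only [orderBoundary, orderChainsRep, MonoidHom.coe_mk, OneHom.coe_mk,
      LinearMap.comp_apply, Finsupp.lsingle_apply, Finsupp.lmapDomain_apply,
      Finsupp.mapDomain_single, Finsupp.linearCombination_single, one_smul,
      Finsupp.mapDomain_finsetSum]
    rfl
  exact LinearMap.congr_fun h x

theorem orderCycles_invariant {G : Type} [Group G] {Q : Type} [PartialOrder Q]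
    (α : G →* (Q ≃o Q)) (k : ℕ) (g : G) :
    orderCycles Q k ≤ (orderCycles Q k).comap (orderChainsRep α k g) := by
  intro x hx
  cases k with
  | zero => exact Submodule.mem_top
  | succ k =>
    have hx' : orderBoundary Q k x = 0 := hx
    change orderBoundary Q k (orderChainsRep α (k + 1) g x) = 0
    rw [orderBoundary_orderChainsRep, hx', map_zero]

theorem orderBoundaries_invariant {G : Type} [Group G] {Q : Type} [PartialOrder Q]
    (α : G →* (Q ≃o Q)) (k : ℕ) (g : G) :
    orderBoundaries Q k ≤ (orderBoundaries Q k).comap (orderChainsRep α k g) := by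
  rintro x ⟨y, hy⟩
  exact ⟨orderChainsRep α (k + 1) g y,
    (orderBoundary_orderChainsRep α k g y).trans (congrArg (orderChainsRep α k g) hy)⟩

/-- The subquotient representation `Z / (B ∩ Z)` for two invariant subspaces `Z` and `B` of a
representation. -/
noncomputable def subquotientRep {G V : Type} [Group G] [AddCommGroup V] [Module ℂ V]
    (ρ : Representation ℂ G V) (Z B : Submodule ℂ V) (hZ : ∀ g, Z ≤ Z.comap (ρ g))
    (hB : ∀ g, B ≤ B.comap (ρ g)) : Representation ℂ G (Z ⧸ B.submoduleOf Z) :=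
  (ρ.subrepresentation Z hZ).quotient (B.submoduleOf Z) fun g _ hx => hB g hx

/-- The representation of `G` on the reduced homology `H̃_{k-1}(Q; ℂ)` (cycles modulo boundaries)
of the order complex of `Q`. -/
noncomputable def orderHomology {G : Type} [Group G] {Q : Type} [PartialOrder Q]
    (α : G →* (Q ≃o Q)) (k : ℕ) : Rep.{0} ℂ G :=
  Rep.of (subquotientRep (orderChainsRep α k) (orderCycles Q k) (orderBoundaries Q k)
    (orderCycles_invariant α k) (orderBoundaries_invariant α k))

/-! ## The proper part of a bounded poset -/

/-- The proper part of a bounded poset: all elements but the bottom and the top. -/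
abbrev ProperPart (P : Type) [PartialOrder P] [BoundedOrder P] : Type :=
  {x : P // x ≠ ⊥ ∧ x ≠ ⊤}

/-- An action by order automorphisms on a bounded poset restricts to its proper part. -/
def properPartAction {G : Type} [Group G] {P : Type} [PartialOrder P] [BoundedOrder P]
    (α : G →* (P ≃o P)) : G →* (ProperPart P ≃o ProperPart P) where
  toFun g :=
    { toEquiv := (α g).toEquiv.subtypeEquiv fun x => by simp
      map_rel_iff' := (α g).map_rel_iff }
  map_one' := by
    ext x
    change (α 1) x.1 = x.1
    rw [map_one]
    rfl
  map_mul' g h := by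
    ext x
    change (α (g * h)) x.1 = (α g) ((α h) x.1)
    rw [map_mul]
    rfl

open Classical in
/-- The reduced homology `H̃_j(P̄; ℂ)`, for `j : ℤ`, of the proper part `P̄` of a bounded poset `P`
on which `G` acts.  If `P` has more than one element, it is the reduced simplicial homology of
the order complex of `P̄` (which is the complex `{∅}` if `P̄` is empty).  If `P` has only one
element, the complex is by convention the degenerate empty complex, whose homology is the
one-dimensional trivial representation in degree `-2`, and zero in the other degrees. -/
noncomputable def properPartHomology {G : Type} [Group G] {P : Type} [PartialOrder P]
    [BoundedOrder P] (α : G →* (P ≃o P)) (j : ℤ) : Rep.{0} ℂ G :=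
  if (⊥ : P) = ⊤ then
    if j = -2 then Rep.trivial ℂ G ℂ else Rep.trivial ℂ G PUnit
  else
    if -1 ≤ j then orderHomology (properPartAction α) (j + 1).toNat
    else Rep.trivial ℂ G PUnit

/-! ## The partition lattice -/

/-- The lattice of partitions of `{0, …, n-1}`, a partition being given by its equivalence
relation; `r ≤ s` means that `r` refines `s`, the bottom is the partition into singletons and the
top is the partition into one block. -/
abbrev PartitionLattice (n : ℕ) : Type := Setoid (Fin n)

/-- The action of the symmetric group on the partition lattice: the blocks of `σ r` are the images
under `σ` of the blocks of `r`. -/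
def partitionAction (n : ℕ) :
    Equiv.Perm (Fin n) →* (PartitionLattice n ≃o PartitionLattice n) where
  toFun σ :=
    { toFun := fun r => r.comap ⇑σ⁻¹
      invFun := fun r => r.comap ⇑σ
      left_inv := fun r => by ext x y; simp [Setoid.comap_rel]
      right_inv := fun r => by ext x y; simp [Setoid.comap_rel]
      map_rel_iff' := fun {r s} =>
        ⟨fun h x y hxy => by
          have h' : r (σ⁻¹ (σ x)) (σ⁻¹ (σ y)) → s (σ⁻¹ (σ x)) (σ⁻¹ (σ y)) := @h (σ x) (σ y)
          simp only [Equiv.Perm.inv_def, Equiv.symm_apply_apply] at h'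
          exact h' hxy,
        fun h x y hxy => h hxy⟩ }
  map_one' := by
    ext r x y
    rfl
  map_mul' σ τ := by
    ext r x y
    change r ((σ * τ)⁻¹ x) ((σ * τ)⁻¹ y) ↔ r (τ⁻¹ (σ⁻¹ x)) (τ⁻¹ (σ⁻¹ y))
    rw [mul_inv_rev]
    rfl

/-! ## One-dimensional representations -/

/-- The one-dimensional representation with character `χ`. -/
noncomputable def linearCharacterRep {G : Type} [Group G] (χ : G →* ℂˣ) : Representation ℂ G ℂ :=
  ((Algebra.lmul ℂ ℂ : ℂ →* Module.End ℂ ℂ).comp (Units.coeHom ℂ)).comp χ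

/-- The sign representation of the symmetric group on `n` letters. -/
noncomputable def signRep (n : ℕ) : Representation ℂ (Equiv.Perm (Fin n)) ℂ :=
  linearCharacterRep ((Units.map (Int.castRingHom ℂ).toMonoidHom).comp Equiv.Perm.sign)

/-- The subgroup generated by the cycle `(0, 1, …, n-1)`. -/
abbrev cyclicSubgroup (n : ℕ) : Subgroup (Equiv.Perm (Fin n)) :=
  Subgroup.zpowers (finRotate n)

/-- The cycle `(0, 1, …, n-1)` as an element of the subgroup that it generates. -/
def cyclicGenerator (n : ℕ) : cyclicSubgroup n :=
  ⟨finRotate n, Subgroup.mem_zpowers _⟩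

theorem mem_zpowers_cyclicGenerator (n : ℕ) (x : cyclicSubgroup n) :
    x ∈ Subgroup.zpowers (cyclicGenerator n) := by
  obtain ⟨x, k, rfl⟩ := x
  exact ⟨k, Subtype.ext (by simp [cyclicGenerator])⟩

/-- The complex number `e^{2πi/n}` as a unit. -/
noncomputable def rootUnit (n : ℕ) : ℂˣ :=
  Units.mk0 (Complex.exp (2 * Real.pi * Complex.I / n)) (Complex.exp_ne_zero _)

theorem orderOf_rootUnit_dvd (n : ℕ) : orderOf (rootUnit n) ∣ orderOf (cyclicGenerator n) := by
  have hgen : orderOf (cyclicGenerator n) = orderOf (finRotate n) :=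
    Subgroup.orderOf_mk _ _
  rw [hgen]
  match n with
  | 0 =>
    have : rootUnit 0 = 1 := Units.ext (by simp [rootUnit])
    simp [this]
  | 1 =>
    have : rootUnit 1 = 1 := Units.ext (by simp [rootUnit])
    simp [this]
  | n + 2 =>
    rw [isCycle_finRotate.orderOf, support_finRotate, Finset.card_univ, Fintype.card_fin]
    refine orderOf_dvd_of_pow_eq_one (Units.ext ?_)
    have h := (Complex.isPrimitiveRoot_exp (n + 2) (by omega)).pow_eq_one
    simpa [rootUnit] using h

/-- The linear character of the cyclic subgroup whose value at the generating cycle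
is `e^{2πi/n}`. -/
noncomputable def cyclicCharacter (n : ℕ) : cyclicSubgroup n →* ℂˣ :=
  monoidHomOfForallMemZpowers (mem_zpowers_cyclicGenerator n) (orderOf_rootUnit_dvd n)

theorem cyclicCharacter_cyclicGenerator (n : ℕ) :
    (cyclicCharacter n (cyclicGenerator n) : ℂ) = Complex.exp (2 * Real.pi * Complex.I / n) := by
  rw [cyclicCharacter, monoidHomOfForallMemZpowers_apply_gen]
  rfl

/-- The representation of the symmetric group induced from the one-dimensional representation
`e^{2πi/n}` of the cyclic subgroup. -/
noncomputable def lieRep (n : ℕ) :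
    Representation ℂ (Equiv.Perm (Fin n))
      (Representation.IndV (cyclicSubgroup n).subtype (linearCharacterRep (cyclicCharacter n))) :=
  Representation.ind (cyclicSubgroup n).subtype (linearCharacterRep (cyclicCharacter n))

/-
Both sides have the same character.

The partition lattice is upper modular, and an induction on intervals that adds one vertex at a time
shows that the reduced homology of its proper part vanishes below the top degree. By the Hopf trace
formula the character of the top homology at `g` is then, up to sign, the reduced Euler
characteristic of the chains of partitions fixed by `g`, which by Philip Hall's theorem is the
Möbius number `μ(⊥, ⊤)` of the lattice of `g`-invariant partitions.

For an element `h` of the cyclic group `C`, let `N r h` be the number of maps `f : Fin n → C` that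
are constant on the blocks of `r` and satisfy `f (g x) = h * f x`. Möbius inversion with `q` copies
of `C` in place of `C`, followed by a comparison of the coefficients of `q`, expresses the number of
injective such maps as `± sgn g` times the sum of `μ(⊥, r) N r h` over the invariant partitions `r`
whose blocks are permuted transitively by `g`. Summed over `h` against a faithful character of `C`,
all terms cancel except `n μ(⊥, ⊤)` for `r = ⊤`. The same weighted sum of the numbers of injective
maps is `n` times the value at `g` of the induced character.
-/

section EqualCharacters

open CategoryTheory CategoryTheory.Limits

universe u

variable {k G V W U : Type u} [Field k] [Group G] [Finite G]
  [AddCommGroup V] [Module k V] [AddCommGroup W] [Module k W] [AddCommGroup U] [Module k U]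
  {ρ : Representation k G V} {σ : Representation k G W} {κ : Representation k G U}

theorem exists_intertwiningMap_comp_comp_eq_self [NeZero (Nat.card G : k)]
    (f : ρ.IntertwiningMap σ) : ∃ t : σ.IntertwiningMap ρ, ∀ x, f (t (f x)) = f x := by
  let F : Rep.of ρ ⟶ Rep.of σ := Rep.ofHom f
  let T : Rep.of σ ⟶ Rep.of ρ :=
    Injective.factorThru (𝟙 (image F)) (image.ι F) ≫
      Projective.factorThru (𝟙 (image F)) (factorThruImage F)
  have hT : F ≫ T ≫ F = F := by
    calc F ≫ T ≫ F = (factorThruImage F ≫ image.ι F) ≫ T ≫ factorThruImage F ≫ image.ι F := by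
          rw [image.fac]
      _ = factorThruImage F ≫ image.ι F := by simp [T, -image.fac, -image.fac_assoc]
      _ = F := image.fac F
  exact ⟨T.hom, fun x => congrArg (fun H : Rep.of ρ ⟶ Rep.of σ => H.hom x) hT⟩

variable [FiniteDimensional k V] [FiniteDimensional k W] [FiniteDimensional k U] [CharZero k]

theorem finrank_intertwiningMap_eq_of_character_eq (κ : Representation k G U)
    (h : ρ.character = σ.character) :
    Module.finrank k (κ.IntertwiningMap ρ) = Module.finrank k (κ.IntertwiningMap σ) := by
  have := Fintype.ofFinite G
  have := invertibleOfNonzero (Nat.cast_ne_zero (R := k).2 (Nat.card_pos (α := G)).ne')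
  have hρσ := κ.card_inv_mul_sum_char_mul_char_eq_finrank ρ
  rw [h, κ.card_inv_mul_sum_char_mul_char_eq_finrank σ] at hρσ
  exact_mod_cast hρσ.symm

theorem exists_intertwiningMap_forall_comp_ne (h : ρ.character = σ.character)
    (f : ρ.IntertwiningMap σ) {ι : κ.IntertwiningMap ρ} (hι : ι ≠ 0) (hfι : f.comp ι = 0) :
    ∃ u : κ.IntertwiningMap σ, ∀ v : κ.IntertwiningMap ρ, f.comp v ≠ u := by
  let Φ : κ.IntertwiningMap ρ →ₗ[k] κ.IntertwiningMap σ :=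
    Representation.IntertwiningMap.llcomp _ _ _ f
  have hΦ : ¬ Function.Injective Φ := fun hinj => hι (hinj (hfι.trans (map_zero Φ).symm))
  rw [LinearMap.injective_iff_surjective_of_finrank_eq_finrank
    (finrank_intertwiningMap_eq_of_character_eq κ h)] at hΦ
  obtain ⟨u, hu⟩ := not_forall.1 hΦ
  exact ⟨u, not_exists.1 hu⟩

/- Since the characters agree, `Hom_G(ker f, ρ)` and `Hom_G(ker f, σ)` have the same dimension, and
`f ∘ -` kills the inclusion of `ker f`; hence some `u : ker f → σ` does not factor through `f`. The
component of `u` in a complement of the range of `f` can be added to `f` on `ker f`. -/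
theorem exists_intertwiningMap_ker_lt (h : ρ.character = σ.character) (f : ρ.IntertwiningMap σ)
    (hf : f.ker.toSubmodule ≠ ⊥) :
    ∃ f' : ρ.IntertwiningMap σ, f'.ker.toSubmodule < f.ker.toSubmodule := by
  obtain ⟨t, ht⟩ := exists_intertwiningMap_comp_comp_eq_self f
  let κ := f.ker.toRepresentation
  let ι : κ.IntertwiningMap ρ := ⟨f.ker.toSubmodule.subtype, fun _ => rfl⟩
  let e : ρ.IntertwiningMap ρ := .id ρ - t.comp f
  have hfe : ∀ x, f (e x) = 0 := fun x => by simp [e, ht]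
  let p : ρ.IntertwiningMap κ :=
    ⟨e.toLinearMap.codRestrict f.ker.toSubmodule hfe,
      fun g => by ext x; exact e.isIntertwining _ _ g x⟩
  have hp : ∀ x : f.ker.toSubmodule, p x = x := fun x => Subtype.ext <| by
    have hx : f (x : V) = 0 := x.2
    change (x : V) - t (f (x : V)) = x
    rw [hx, map_zero, sub_zero]
  have hι : ι ≠ 0 := fun hι => hf <| (Submodule.eq_bot_iff _).2 fun x hx =>
    congrArg (fun v : κ.IntertwiningMap ρ => v ⟨x, hx⟩) hι
  obtain ⟨u, hu⟩ := exists_intertwiningMap_forall_comp_ne h f hι (by ext x; exact x.2)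
  let w : κ.IntertwiningMap σ := u - f.comp (t.comp u)
  have hftw : ∀ x, f (t (w x)) = 0 := fun x => by simp [w, ht]
  let f' : ρ.IntertwiningMap σ := f + w.comp p
  have hle : f'.ker.toSubmodule ≤ f.ker.toSubmodule := fun x (hx : f x + w (p x) = 0) => by
    change f x = 0
    rw [← ht x, eq_neg_of_add_eq_zero_left hx, map_neg, map_neg, hftw, neg_zero]
  refine ⟨f', lt_of_le_of_ne hle fun heq => hu (t.comp u) ?_⟩
  have hw : ∀ x : f.ker.toSubmodule, w x = 0 := fun x => by
    have hx : f (x : V) = 0 := x.2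
    have hx' : f (x : V) + w (p x) = 0 := heq.ge x.2
    rwa [hp, hx, zero_add] at hx'
  ext x
  exact (sub_eq_zero.1 (hw x)).symm

theorem nonempty_equiv_of_character_eq (h : ρ.character = σ.character) :
    Nonempty (ρ.Equiv σ) := by
  obtain ⟨f, hmin⟩ : ∃ f : ρ.IntertwiningMap σ, ∀ f' : ρ.IntertwiningMap σ,
      ¬ f'.ker.toSubmodule < f.ker.toSubmodule := by
    obtain ⟨_, ⟨f, rfl⟩, hf⟩ := WellFounded.has_min (wellFounded_lt (α := Submodule k V))
      (Set.range fun f : ρ.IntertwiningMap σ => f.ker.toSubmodule) (Set.range_nonempty _)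
    exact ⟨f, fun f' => hf _ ⟨f', rfl⟩⟩
  have hker : f.ker.toSubmodule = ⊥ := by
    by_contra hf
    obtain ⟨f', hf'⟩ := exists_intertwiningMap_ker_lt h f hf
    exact hmin f' hf'
  have hdim : Module.finrank k V = Module.finrank k W := by
    have hone := congrFun h 1
    rw [Representation.char_one, Representation.char_one] at hone
    exact_mod_cast hone
  have hinj : Function.Injective f.toLinearMap := LinearMap.ker_eq_bot.1 hker
  exact ⟨f.ofBijective
    ⟨hinj, (LinearMap.injective_iff_surjective_of_finrank_eq_finrank hdim).1 hinj⟩⟩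

theorem nonempty_iso_of_character_eq {A B : Rep.{u} k G} [FiniteDimensional k A]
    [FiniteDimensional k B] (h : A.ρ.character = B.ρ.character) : Nonempty (A ≅ B) :=
  (nonempty_equiv_of_character_eq h).map Rep.mkIso

end EqualCharacters

theorem trace_eq_trace_restrict_ker_add {k V W : Type*} [Field k] [AddCommGroup V] [Module k V]
    [FiniteDimensional k V] [AddCommGroup W] [Module k W] [FiniteDimensional k W]
    (f : V →ₗ[k] W) (hf : Function.Surjective f) (a : V →ₗ[k] V) (b : W →ₗ[k] W)
    (hab : f ∘ₗ a = b ∘ₗ f) {p : Submodule k V} (hp : LinearMap.ker f = p)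
    (ha : ∀ x ∈ p, a x ∈ p) :
    LinearMap.trace k V a = LinearMap.trace k p (a.restrict ha) + LinearMap.trace k W b := by
  subst hp
  obtain ⟨s, hs⟩ := f.exists_rightInverse_of_surjective (LinearMap.range_eq_top.2 hf)
  have hfs : ∀ y, f (s y) = y := LinearMap.congr_fun hs
  let p : V →ₗ[k] LinearMap.ker f := LinearMap.codRestrict _ (LinearMap.id - s ∘ₗ f) fun x => by
    simp [hfs]
  have hker : a.restrict ha = p ∘ₗ (a ∘ₗ (LinearMap.ker f).subtype) := by
    ext x
    have hx : f (a x) = 0 := ha x x.2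
    simp [p, hx]
  have hquot : b = f ∘ₗ (a ∘ₗ s) := by
    rw [← LinearMap.comp_assoc, hab, LinearMap.comp_assoc, hs, LinearMap.comp_id]
  rw [hker, hquot, LinearMap.trace_comp_comm', LinearMap.trace_comp_comm' (a ∘ₗ s) f, ← map_add]
  congr 1
  ext x
  simp [p]

theorem trace_lmapDomain (R : Type*) [CommRing R] {ι : Type*} [Finite ι] (π : ι → ι) :
    LinearMap.trace R (ι →₀ R) (Finsupp.lmapDomain R R π) = Nat.card {i // π i = i} := by
  classical
  have := Fintype.ofFinite ι
  rw [LinearMap.trace_eq_matrix_trace R (Finsupp.basisSingleOne (R := R) (ι := ι)), Matrix.trace,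
    Nat.card_eq_fintype_card, Fintype.card_subtype, Finset.card_filter, Nat.cast_sum]
  refine Finset.sum_congr rfl fun i _ => ?_
  simp [LinearMap.toMatrix_apply, Finsupp.mapDomain_single, Finsupp.single_apply]

section InducedCharacter

open Representation

theorem trace_coinvariants {k G V : Type*} [Field k] [Group G] [Fintype G]
    [Invertible (Fintype.card G : k)] [AddCommGroup V] [Module k V] [FiniteDimensional k V]
    (ρ : Representation k G V) (a : V →ₗ[k] V) (b : ρ.Coinvariants →ₗ[k] ρ.Coinvariants)
    (hab : b ∘ₗ Coinvariants.mk ρ = Coinvariants.mk ρ ∘ₗ a) :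
    LinearMap.trace k _ b =
      (Fintype.card G : k)⁻¹ * ∑ g : G, LinearMap.trace k V (ρ g ∘ₗ a) := by
  have havg : ρ.averageMap = (Fintype.card G : k)⁻¹ • ∑ g : G, ρ g := by
    simp [averageMap, GroupAlgebra.average]
  have havg_comp : ∀ g, ρ.averageMap ∘ₗ ρ g = ρ.averageMap := fun g => by
    rw [averageMap, ← asAlgebraHom_single_one, ← Module.End.mul_eq_comp, ← map_mul,
      GroupAlgebra.mul_average_right]
  let s := Coinvariants.lift ρ ρ.averageMap havg_comp
  let q := Coinvariants.mk ρ
  have hqs : q ∘ₗ s = LinearMap.id := Coinvariants.hom_ext <| by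
    rw [LinearMap.comp_assoc, Coinvariants.lift_comp_mk, havg]
    ext x
    have hq : ∀ g, q (ρ g x) = q x := fun g => Coinvariants.mk_self_apply ρ g x
    simp [hq, q, ← Nat.cast_smul_eq_nsmul k, smul_smul]
  calc LinearMap.trace k _ b
      = LinearMap.trace k _ (q ∘ₗ (a ∘ₗ s)) := by
        rw [← LinearMap.comp_assoc, ← hab, LinearMap.comp_assoc, hqs, LinearMap.comp_id]
    _ = LinearMap.trace k V ((s ∘ₗ q) ∘ₗ a) := by
        rw [LinearMap.trace_comp_comm', LinearMap.comp_assoc, LinearMap.trace_comp_comm']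
    _ = (Fintype.card G : k)⁻¹ * ∑ g : G, LinearMap.trace k V (ρ g ∘ₗ a) := by
        rw [Coinvariants.lift_comp_mk, havg, LinearMap.smul_comp, ← Module.End.mul_eq_comp,
          Finset.sum_mul, map_smul, map_sum, smul_eq_mul]
        rfl

theorem trace_linearCharacterRep {G : Type} [Group G] (χ : G →* ℂˣ) (g : G) :
    LinearMap.trace ℂ ℂ (linearCharacterRep χ g) = χ g := by
  have hsmul : linearCharacterRep χ g = (χ g : ℂ) • LinearMap.id := by
    ext
    simp [linearCharacterRep]
  rw [hsmul, map_smul, LinearMap.trace_id]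
  simp

open scoped MonoidAlgebra

theorem trace_leftRegular_comp_mulRight {k G : Type*} [Field k] [Group G] [Finite G] (h g : G) :
    LinearMap.trace k k[G] (leftRegular k G h ∘ₗ
      MonoidAlgebra.mapDomainLinearMap k k fun x => x * g) = Nat.card {x : G // h * x * g = x} := by
  rw [← LinearMap.trace_conj' _ (MonoidAlgebra.coeffLinearEquiv k), ← trace_lmapDomain]
  congr 1
  ext x : 2
  simp [LinearEquiv.conj_apply, mul_assoc]

theorem character_ind_linearCharacterRep {G : Type} [Group G] [Finite G] (H : Subgroup G)
    [Fintype H] (χ : H →* ℂˣ) (g : G) :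
    (ind H.subtype (linearCharacterRep χ)).character g =
      (Fintype.card H : ℂ)⁻¹ * ∑ h : H, (Nat.card {x : G // x * g * x⁻¹ = h} : ℂ) * (χ h : ℂ) := by
  have : Invertible (Fintype.card H : ℂ) := invertibleOfNonzero (by simp)
  have : Module.Finite ℂ ℂ[G] := Module.Finite.equiv (MonoidAlgebra.coeffLinearEquiv ℂ).symm
  have : Module.Free ℂ ℂ[G] := Module.Free.of_equiv (MonoidAlgebra.coeffLinearEquiv ℂ).symm
  let R : ℂ[G] →ₗ[ℂ] ℂ[G] := MonoidAlgebra.mapDomainLinearMap ℂ ℂ fun x => x * g⁻¹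
  rw [character, trace_coinvariants _ (R.rTensor ℂ) _ rfl]
  congr 1
  refine Finset.sum_congr rfl fun h _ => ?_
  have hmap : tprod ((leftRegular ℂ G).comp H.subtype) (linearCharacterRep χ) h ∘ₗ R.rTensor ℂ =
      TensorProduct.map (leftRegular ℂ G h ∘ₗ R) (linearCharacterRep χ h) := by
    ext
    simp [R]
  rw [hmap, LinearMap.trace_tensorProduct', trace_leftRegular_comp_mulRight,
    trace_linearCharacterRep]
  congr 2
  refine Nat.card_congr (Equiv.subtypeEquivRight fun x => ?_)
  rw [mul_inv_eq_iff_eq_mul, mul_inv_eq_iff_eq_mul, eq_comm]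

end InducedCharacter

section Acyclic

variable {P : Type} [PartialOrder P]

/-- The chains of the order complex of `P` that are supported on simplices inside `S`. -/
noncomputable def chainsIn (S : Set P) (k : ℕ) : Submodule ℂ (OrderChains P k) :=
  Finsupp.supported ℂ ℂ {c | ∀ i, c i ∈ S}

theorem mem_chainsIn {S : Set P} {k : ℕ} {z : OrderChains P k} :
    z ∈ chainsIn S k ↔ ∀ c, z c ≠ 0 → ∀ i, c i ∈ S := by
  simp [chainsIn, Finsupp.mem_supported, Set.subset_def]

theorem single_mem_chainsIn {S : Set P} {k : ℕ} {c : Fin k ↪o P} (hc : ∀ i, c i ∈ S) (a : ℂ) :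
    Finsupp.single c a ∈ chainsIn S k :=
  Finsupp.single_mem_supported ℂ a hc

theorem chainsIn_mono {S T : Set P} (h : S ⊆ T) (k : ℕ) : chainsIn S k ≤ chainsIn T k :=
  Finsupp.supported_mono fun _ hc i => h (hc i)

theorem chainsIn_zero (S : Set P) : chainsIn S 0 = ⊤ :=
  eq_top_iff.2 fun _ _ => mem_chainsIn.2 fun _ _ i => i.elim0

theorem chainsIn_le_iff {S : Set P} {k : ℕ} {M : Submodule ℂ (OrderChains P k)} :
    chainsIn S k ≤ M ↔ ∀ c : Fin k ↪o P, (∀ i, c i ∈ S) → Finsupp.single c 1 ∈ M := by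
  rw [chainsIn, Finsupp.supported_eq_span_single, Submodule.span_le]
  simp [Set.subset_def]

/-- The face of a chain opposite to the `i`-th vertex. -/
def face {k : ℕ} (c : Fin (k + 1) ↪o P) (i : Fin (k + 1)) : Fin k ↪o P :=
  (Fin.succAboveOrderEmb i).trans c

@[simp] theorem face_apply {k : ℕ} (c : Fin (k + 1) ↪o P) (i : Fin (k + 1)) (j : Fin k) :
    face c i j = c (i.succAbove j) := rfl

theorem face_face_succAbove_predAbove {k : ℕ} (c : Fin (k + 2) ↪o P) (i : Fin (k + 2))
    (j : Fin (k + 1)) : face (face c (i.succAbove j)) (j.predAbove i) = face (face c i) j := by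
  ext l
  simp [Fin.succAbove_succAbove_succAbove_predAbove]

theorem range_eq_insert_range_face {k : ℕ} (c : Fin (k + 1) ↪o P) (p : Fin (k + 1)) :
    Set.range c = insert (c p) (Set.range (face c p)) := by
  ext y
  simp only [Set.mem_range, Set.mem_insert_iff, face_apply, Fin.exists_iff_succAbove p, eq_comm]

theorem orderBoundary_single {k : ℕ} (c : Fin (k + 1) ↪o P) (a : ℂ) :
    orderBoundary P k (Finsupp.single c a) = ∑ i : Fin (k + 1),
      Finsupp.single (face c i) (a * (-1) ^ (i : ℕ)) := by
  simp [orderBoundary, face, Finset.smul_sum]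

theorem orderBoundary_mem_chainsIn {S : Set P} {k : ℕ} {z : OrderChains P (k + 1)}
    (hz : z ∈ chainsIn S (k + 1)) : orderBoundary P k z ∈ chainsIn S k := by
  refine (chainsIn_le_iff (M := (chainsIn S k).comap (orderBoundary P k))).2 (fun c hc => ?_) hz
  rw [Submodule.mem_comap, orderBoundary_single]
  exact Submodule.sum_mem _ fun i _ => single_mem_chainsIn (fun j => hc (i.succAbove j)) _

/-- The elements of `S` that are comparable to `x` and different from `x`: the vertices of the link
of `x` in the order complex of `S`. -/
def linkSet (S : Set P) (x : P) : Set P := {y ∈ S | y < x ∨ x < y}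

open Classical in
/-- The map that removes the vertex `x`, with the sign of its position, from the chains through `x`
and kills the other chains. -/
noncomputable def vertexRemoval (x : P) (k : ℕ) : OrderChains P (k + 1) →ₗ[ℂ] OrderChains P k :=
  Finsupp.linearCombination ℂ fun c : Fin (k + 1) ↪o P =>
    ∑ p : Fin (k + 1), Finsupp.single (face c p) (if c p = x then (-1 : ℂ) ^ (p : ℕ) else 0)

open Classical in
theorem vertexRemoval_single (x : P) {k : ℕ} (c : Fin (k + 1) ↪o P) (a : ℂ) :
    vertexRemoval x k (Finsupp.single c a) = ∑ p : Fin (k + 1),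
      Finsupp.single (face c p) (a * if c p = x then (-1) ^ (p : ℕ) else 0) := by
  simp only [vertexRemoval, Finsupp.linearCombination_single, Finset.smul_sum, Finsupp.smul_single,
    smul_eq_mul]

theorem vertexRemoval_single_of_apply_eq {x : P} {k : ℕ} {c : Fin (k + 1) ↪o P}
    {p : Fin (k + 1)} (hp : c p = x) (a : ℂ) :
    vertexRemoval x k (Finsupp.single c a) = Finsupp.single (face c p) (a * (-1) ^ (p : ℕ)) := by
  have hne : ∀ q ≠ p, c q ≠ x := fun q hq hqx => hq (c.injective (hqx.trans hp.symm))
  rw [vertexRemoval_single, Finset.sum_eq_single_of_mem p (Finset.mem_univ p) fun q _ hq => by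
    rw [if_neg (hne q hq), mul_zero, Finsupp.single_zero], if_pos hp]

theorem vertexRemoval_single_of_forall_ne {x : P} {k : ℕ} {c : Fin (k + 1) ↪o P}
    (hc : ∀ p, c p ≠ x) (a : ℂ) : vertexRemoval x k (Finsupp.single c a) = 0 := by
  simp [vertexRemoval_single, hc]

open Classical in
theorem vertexRemoval_orderBoundary (x : P) {k : ℕ} (z : OrderChains P (k + 2)) :
    vertexRemoval x k (orderBoundary P (k + 1) z) =
      -orderBoundary P k (vertexRemoval x (k + 1) z) := by
  suffices h : vertexRemoval x k ∘ₗ orderBoundary P (k + 1) =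
      -(orderBoundary P k ∘ₗ vertexRemoval x (k + 1)) from LinearMap.congr_fun h z
  ext c : 2
  let swap : Fin (k + 2) × Fin (k + 1) → Fin (k + 2) × Fin (k + 1) :=
    fun p => (p.1.succAbove p.2, p.2.predAbove p.1)
  have hswap : Function.Involutive swap := fun p =>
    Prod.ext (Fin.succAbove_succAbove_predAbove _ _) (Fin.predAbove_predAbove_succAbove _ _)
  simp only [LinearMap.comp_apply, LinearMap.neg_apply, Finsupp.lsingle_apply,
    orderBoundary_single, vertexRemoval_single, map_sum, ← Finset.sum_neg_distrib,
    ← Finsupp.single_neg]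
  rw [← Fintype.sum_prod_type', ← Fintype.sum_prod_type']
  refine Fintype.sum_equiv hswap.toPerm _ _ fun ⟨i, j⟩ => ?_
  have hsign := Fin.neg_one_pow_succAbove_add_predAbove (R := ℂ) i j
  rw [pow_add, pow_add] at hsign
  change Finsupp.single (face (face c i) j) (1 * (-1) ^ (i : ℕ) *
      if face c i j = x then (-1) ^ (j : ℕ) else 0) =
    Finsupp.single (face (face c (i.succAbove j)) (j.predAbove i)) (-((1 *
      if c (i.succAbove j) = x then (-1) ^ (i.succAbove j : ℕ) else 0) *
      (-1) ^ (j.predAbove i : ℕ)))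
  rw [face_face_succAbove_predAbove, face_apply]
  congr 1
  split_ifs
  · linear_combination hsign
  · ring

theorem vertexRemoval_mem_chainsIn {S : Set P} (x : P) {k : ℕ} {z : OrderChains P (k + 1)}
    (hz : z ∈ chainsIn S (k + 1)) : vertexRemoval x k z ∈ chainsIn (linkSet S x) k := by
  refine (chainsIn_le_iff (M := (chainsIn _ k).comap (vertexRemoval x k))).2 (fun c hc => ?_) hz
  rw [Submodule.mem_comap]
  by_cases hx : ∃ p, c p = x
  · obtain ⟨p, hp⟩ := hx
    rw [vertexRemoval_single_of_apply_eq hp]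
    have hlink : ∀ i, face c p i ∈ linkSet S x := fun i => by
      refine ⟨hc _, ?_⟩
      rw [← hp, face_apply, c.lt_iff_lt, c.lt_iff_lt]
      exact (p.succAbove_ne i).lt_or_gt
    exact single_mem_chainsIn hlink _
  · rw [vertexRemoval_single_of_forall_ne (not_exists.1 hx)]
    exact zero_mem _

theorem exists_face_eq {x : P} {k : ℕ} (c : Fin k ↪o P) (hc : ∀ i, c i < x ∨ x < c i) :
    ∃ (d : Fin (k + 1) ↪o P) (p : Fin (k + 1)), d p = x ∧ face d p = c := by
  classical
  have hex : ∃ m : ℕ, ∀ i : Fin k, m ≤ i → x < c i := ⟨k, fun i hi => absurd i.2 hi.not_gt⟩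
  have hlt : ∀ i : Fin k, (i : ℕ) < Nat.find hex → c i < x := fun i hi => by
    obtain ⟨j, hij, hj⟩ : ∃ j : Fin k, (i : ℕ) ≤ j ∧ ¬ x < c j := by
      simpa using Nat.find_min hex hi
    exact (c.monotone hij).trans_lt ((hc j).resolve_right hj)
  let p : Fin (k + 1) := ⟨Nat.find hex, Nat.lt_succ_of_le <| Nat.find_min' hex fun i hi =>
    absurd i.2 hi.not_gt⟩
  have hd : StrictMono (p.insertNth x c : Fin (k + 1) → P) := fun i j hij => by
    rcases p.eq_self_or_eq_succAbove i with rfl | ⟨i, rfl⟩ <;>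
      rcases p.eq_self_or_eq_succAbove j with rfl | ⟨j, rfl⟩
    · exact absurd hij (lt_irrefl _)
    · simpa using Nat.find_spec hex j (Fin.lt_succAbove_iff_le_castSucc _ _ |>.1 hij)
    · simpa using hlt i (Fin.succAbove_lt_iff_castSucc_lt _ _ |>.1 hij)
    · simpa using Fin.succAbove_lt_succAbove_iff.1 hij
  exact ⟨OrderEmbedding.ofStrictMono _ hd, p, by simp, by ext i; simp⟩

theorem exists_vertexRemoval_eq {S : Set P} {x : P} (hx : x ∈ S) {k : ℕ} {w : OrderChains P k}
    (hw : w ∈ chainsIn (linkSet S x) k) : ∃ y ∈ chainsIn S (k + 1), vertexRemoval x k y = w := by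
  suffices h : chainsIn (linkSet S x) k ≤ (chainsIn S (k + 1)).map (vertexRemoval x k) from h hw
  refine chainsIn_le_iff.2 fun c hc => ?_
  obtain ⟨d, p, hdp, rfl⟩ := exists_face_eq c fun i => (hc i).2
  have hd : ∀ q, d q ∈ S := (p.forall_iff_succAbove).2 ⟨hdp ▸ hx, fun i => (hc i).1⟩
  refine ⟨Finsupp.single d ((-1) ^ (p : ℕ)), single_mem_chainsIn hd _, ?_⟩
  rw [vertexRemoval_single_of_apply_eq hdp, ← mul_pow]
  norm_num

theorem vertexRemoval_apply_face {x : P} {k : ℕ} (z : OrderChains P (k + 1))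
    {c : Fin (k + 1) ↪o P} {p : Fin (k + 1)} (hp : c p = x) :
    vertexRemoval x k z (face c p) = z c * (-1) ^ (p : ℕ) := by
  classical
  induction z using Finsupp.induction_linear with
  | zero => simp
  | add z w hz hw => rw [map_add, Finsupp.add_apply, hz, hw, Finsupp.add_apply, add_mul]
  | single d a =>
    rcases eq_or_ne d c with rfl | hdc
    · rw [vertexRemoval_single_of_apply_eq hp, Finsupp.single_eq_same, Finsupp.single_eq_same]
    rw [Finsupp.single_eq_of_ne hdc.symm, zero_mul]
    by_cases hx : ∃ q, d q = x
    · obtain ⟨q, hq⟩ := hx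
      have hface : face d q ≠ face c p := fun h => hdc <| by
        have hrange : Set.range d = Set.range c := by
          rw [range_eq_insert_range_face d q, range_eq_insert_range_face c p, h, hq, hp]
        exact OrderEmbedding.range_inj.1 hrange
      rw [vertexRemoval_single_of_apply_eq hq, Finsupp.single_eq_of_ne hface.symm]
    · rw [vertexRemoval_single_of_forall_ne (not_exists.1 hx), Finsupp.zero_apply]

theorem mem_chainsIn_of_vertexRemoval_eq_zero {S : Set P} {x : P} {k : ℕ}
    {z : OrderChains P (k + 1)} (hz : z ∈ chainsIn S (k + 1)) (h : vertexRemoval x k z = 0) :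
    z ∈ chainsIn (S \ {x}) (k + 1) := by
  refine mem_chainsIn.2 fun c hc p => ⟨mem_chainsIn.1 hz c hc p, fun hp => hc ?_⟩
  have happly := vertexRemoval_apply_face z (Set.mem_singleton_iff.1 hp)
  rw [h, Finsupp.zero_apply] at happly
  exact (mul_eq_zero.1 happly.symm).resolve_right (by simp)

/-- The reduced homology of the order complex of `S` vanishes on chains with fewer than `m`
elements. -/
def AcyclicBelow (S : Set P) (m : ℕ) : Prop :=
  ∀ k < m, ∀ z ∈ chainsIn S k, z ∈ orderCycles P k →
    ∃ w ∈ chainsIn S (k + 1), orderBoundary P k w = z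

theorem acyclicBelow_zero (S : Set P) : AcyclicBelow S 0 := fun k hk => absurd hk k.not_lt_zero

theorem AcyclicBelow.mono {S : Set P} {m m' : ℕ} (h : AcyclicBelow S m') (hm : m ≤ m') :
    AcyclicBelow S m :=
  fun k hk => h k (hk.trans_le hm)

theorem vertexRemoval_mem_orderCycles (x : P) {k : ℕ} {z : OrderChains P (k + 1)}
    (hz : z ∈ orderCycles P (k + 1)) : vertexRemoval x k z ∈ orderCycles P k := by
  cases k with
  | zero => exact Submodule.mem_top
  | succ k =>
    have hz : orderBoundary P (k + 1) z = 0 := hz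
    change orderBoundary P k _ = 0
    rw [← neg_eq_zero, ← vertexRemoval_orderBoundary, hz, map_zero]

/- If `w` bounds the link part of a cycle `z`, then adding the boundary of the cone over `w` with
apex `x` moves `z` off the vertex `x`. -/
theorem AcyclicBelow.of_link {S : Set P} {x : P} (hx : x ∈ S) {m : ℕ}
    (hlink : AcyclicBelow (linkSet S x) m) (hdel : AcyclicBelow (S \ {x}) (m + 1)) :
    AcyclicBelow S (m + 1) := by
  have hsub : S \ {x} ⊆ S := Set.sdiff_subset
  rintro (_ | k) hk z hzS hz
  · obtain ⟨w, hw, hwz⟩ := hdel 0 hk z (chainsIn_zero (S \ {x}) ▸ Submodule.mem_top) hz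
    exact ⟨w, chainsIn_mono hsub _ hw, hwz⟩
  obtain ⟨w, hw, hwz⟩ := hlink k (Nat.lt_of_succ_lt_succ hk) _ (vertexRemoval_mem_chainsIn x hzS)
    (vertexRemoval_mem_orderCycles x hz)
  obtain ⟨y, hy, rfl⟩ := exists_vertexRemoval_eq hx hw
  have hbb : ∀ v, orderBoundary P k (orderBoundary P (k + 1) v) = 0 :=
    LinearMap.congr_fun (orderBoundary_orderBoundary P k)
  have hdel_mem : z + orderBoundary P (k + 1) y ∈ chainsIn (S \ {x}) (k + 1) :=
    mem_chainsIn_of_vertexRemoval_eq_zero (add_mem hzS (orderBoundary_mem_chainsIn hy))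
      (by rw [map_add, vertexRemoval_orderBoundary, hwz, add_neg_cancel])
  obtain ⟨v, hv, hvz⟩ := hdel (k + 1) hk _ hdel_mem (add_mem hz (hbb y))
  exact ⟨v - y, sub_mem (chainsIn_mono hsub _ hv) hy, by rw [map_sub, hvz, add_sub_cancel_right]⟩

theorem acyclicBelow_singleton (a : P) (m : ℕ) : AcyclicBelow {a} m := by
  have hD {k : ℕ} {w : OrderChains P (k + 1)} (hw : w ∈ chainsIn {a} (k + 1)) :
      vertexRemoval a k w = orderBoundary P k w := by
    refine (chainsIn_le_iff (M := LinearMap.eqLocus _ _)).2 (fun c hc => ?_) hw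
    have hca : ∀ p, c p = a := hc
    simp [vertexRemoval_single, orderBoundary_single, hca]
  rintro (_ | k) _ z hzS hz
  · obtain ⟨y, hy, hyz⟩ := exists_vertexRemoval_eq (Set.mem_singleton a)
      (chainsIn_zero (linkSet {a} a) ▸ Submodule.mem_top : z ∈ _)
    exact ⟨y, hy, (hD hy).symm.trans hyz⟩
  · have hz : orderBoundary P k z = 0 := hz
    have hmem := mem_chainsIn_of_vertexRemoval_eq_zero hzS ((hD hzS).trans hz)
    have hz0 : z = 0 := Finsupp.ext fun c => by
      by_contra hc
      exact (mem_chainsIn.1 hmem c hc 0).2 (mem_chainsIn.1 hmem c hc 0).1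
    exact ⟨0, zero_mem _, by rw [map_zero, hz0]⟩

theorem linkSet_ssubset {S : Set P} {x : P} (hx : x ∈ S) : linkSet S x ⊂ S :=
  (Set.ssubset_iff_of_subset fun _ hy => hy.1).2
    ⟨x, hx, fun h => h.2.elim (lt_irrefl x) (lt_irrefl x)⟩

theorem acyclicBelow_of_forall_comparable [Finite P] {S : Set P} {a : P} (ha : a ∈ S)
    (hS : ∀ x ∈ S, x ≤ a ∨ a ≤ x) (m : ℕ) : AcyclicBelow S m := by
  induction S using WellFoundedLT.induction generalizing m with
  | ind S ih =>
    obtain _ | m := m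
    · exact acyclicBelow_zero S
    by_cases hex : ∃ x ∈ S, x ≠ a
    · obtain ⟨x, hx, hxa⟩ := hex
      refine AcyclicBelow.of_link hx
        (ih _ (linkSet_ssubset hx) ⟨ha, ?_⟩ (fun y hy => hS y hy.1) m)
        (ih _ (Set.sdiff_singleton_ssubset.2 hx) ⟨ha, hxa.symm⟩ (fun y hy => hS y hy.1) (m + 1))
      exact (hS x hx).symm.imp (lt_of_le_of_ne · hxa.symm) (lt_of_le_of_ne · hxa)
    · push Not at hex
      rw [(Set.eq_singleton_iff_unique_mem).2 ⟨ha, hex⟩]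
      exact acyclicBelow_singleton a _

theorem AcyclicBelow.union_of_isAntichain [Finite P] {S T : Set P} {m : ℕ}
    (hS : AcyclicBelow S (m + 1)) (hT : IsAntichain (· ≤ ·) T)
    (hlink : ∀ x ∈ T, AcyclicBelow (linkSet S x) m) : AcyclicBelow (S ∪ T) (m + 1) := by
  induction T, T.toFinite using Set.Finite.induction_on with
  | empty => rwa [Set.union_empty]
  | @insert x T hxT _ ih =>
    have hST := ih (hT.subset (Set.subset_insert x T)) fun y hy => hlink y (.inr hy)
    by_cases hxS : x ∈ S
    · rwa [Set.union_insert, Set.insert_eq_of_mem (.inl hxS)]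
    refine AcyclicBelow.of_link (.inr (.inl rfl)) ?_ ?_
    · have hlink_eq : linkSet (S ∪ insert x T) x = linkSet S x := by
        ext y
        refine ⟨fun ⟨hy, hyx⟩ => ⟨hy.resolve_right fun hy => ?_, hyx⟩,
          fun ⟨hy, hyx⟩ => ⟨.inl hy, hyx⟩⟩
        exact hyx.elim (fun h => hT hy (.inl rfl) h.ne h.le) fun h => hT (.inl rfl) hy h.ne h.le
      exact hlink_eq ▸ hlink x (.inl rfl)
    · rwa [Set.union_insert, Set.insert_sdiff_self_of_notMem fun h => h.elim hxS hxT]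

end Acyclic

theorem acyclicBelow_of_sup_mem {P : Type} [SemilatticeSup P] [Finite P] {S : Set P} {a : P}
    (ha : a ∈ S) (hS : ∀ x ∈ S, x ⊔ a ∈ S) (m : ℕ) : AcyclicBelow S m := by
  induction S using WellFoundedLT.induction generalizing a m with
  | ind S ih =>
    obtain _ | m := m
    · exact acyclicBelow_zero S
    by_cases hle : ∀ x ∈ S, a ≤ x
    · exact acyclicBelow_of_forall_comparable ha (fun x hx => .inr (hle x hx)) _
    obtain ⟨x, ⟨hx, hax⟩, hmin⟩ := Set.Finite.exists_minimal (Set.toFinite {x ∈ S | ¬ a ≤ x})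
      (by simpa [Set.Nonempty] using hle)
    have hlt {y : P} (hy : y ∈ linkSet S x) : x < y := hy.2.resolve_left fun hyx =>
      hyx.not_ge (hmin ⟨hy.1, fun h => hax (h.trans hyx.le)⟩ hyx.le)
    refine AcyclicBelow.of_link hx (ih _ (linkSet_ssubset hx) (a := x ⊔ a)
      ⟨hS x hx, .inr (left_lt_sup.2 hax)⟩ (fun y hy => ?_) m)
      (ih _ (Set.sdiff_singleton_ssubset.2 hx) (a := a) ⟨ha, fun h => hax h.le⟩
        (fun y hy => ⟨hS y hy.1, fun h => hax (h ▸ le_sup_right)⟩) (m + 1))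
    rw [← sup_assoc, sup_eq_left.2 (hlt hy).le]
    exact ⟨hS y hy.1, .inr ((hlt hy).trans_le le_sup_left)⟩

theorem covBy_sup_of_covBy_of_not_le {P : Type} [Lattice P] [IsUpperModularLattice P] {r a x : P}
    (hra : r ⋖ a) (hrx : r ≤ x) (hax : ¬ a ≤ x) : x ⋖ x ⊔ a := by
  have hinf : a ⊓ x = r :=
    (hra.eq_or_eq (le_inf hra.le hrx) inf_le_left).resolve_right fun h => hax (inf_eq_left.1 h)
  exact sup_comm a x ▸ covBy_sup_of_inf_covBy_left (hinf.symm ▸ hra)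

/- For an atom `a`, the elements with `x ⊔ a < t` form a contractible set. By upper modularity the
elements with `x ⊔ a = t` are coatoms; they are added one at a time, each with link `Ioo r x`. -/
theorem acyclicBelow_Ioo {P : Type} [Lattice P] [IsUpperModularLattice P] [Finite P] {ρ : P → ℕ}
    (hρ : ∀ a b, a ⋖ b → ρ b ≤ ρ a + 1) {r t : P} (hrt : r ≤ t) :
    AcyclicBelow (Set.Ioo r t) (ρ t - ρ r - 1) := by
  induction t using WellFoundedLT.induction with
  | ind t ih =>
    obtain hm | ⟨m, hm⟩ : ρ t - ρ r - 1 = 0 ∨ ∃ m, ρ t - ρ r - 1 = m + 1 :=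
      (Nat.eq_zero_or_eq_succ_pred _).imp_right fun h => ⟨_, h⟩
    · exact hm ▸ acyclicBelow_zero _
    have hlt : r < t := hrt.lt_of_ne fun h => by simp [h] at hm
    obtain ⟨a, hra, hat⟩ := exists_covBy_le_of_lt hlt
    have hat : a < t := hat.lt_of_ne fun h => by have := hρ r t (h ▸ hra); omega
    have hcov {x : P} (hx : x ∈ Set.Ioo r t) (hxa : x ⊔ a = t) : x ⋖ t :=
      hxa ▸ covBy_sup_of_covBy_of_not_le hra hx.1.le fun h => hx.2.ne (sup_eq_left.2 h ▸ hxa)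
    have hsplit : Set.Ioo r t = {x ∈ Set.Ioo r t | x ⊔ a < t} ∪ {x ∈ Set.Ioo r t | x ⊔ a = t} := by
      ext x
      have := fun hx : x ∈ Set.Ioo r t => lt_or_eq_of_le (sup_le hx.2.le hat.le)
      simp only [Set.mem_union, Set.mem_ofPred_eq]
      tauto
    have hlower : AcyclicBelow {x ∈ Set.Ioo r t | x ⊔ a < t} (m + 1) := by
      have ha : a ∈ {x ∈ Set.Ioo r t | x ⊔ a < t} := ⟨⟨hra.lt, hat⟩, by rwa [sup_idem]⟩
      refine acyclicBelow_of_sup_mem ha ?_ _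
      exact fun x ⟨hx, hxa⟩ => ⟨⟨hx.1.trans_le le_sup_left, hxa⟩, by rwa [sup_assoc, sup_idem]⟩
    have hanti : IsAntichain (· ≤ ·) {x ∈ Set.Ioo r t | x ⊔ a = t} :=
      fun x hx y hy hxy hle => (hcov hx.1 hx.2).2 (hle.lt_of_ne hxy) hy.1.2
    rw [hm, hsplit]
    refine hlower.union_of_isAntichain hanti fun x ⟨hx, hxa⟩ => ?_
    have hlink : linkSet {x ∈ Set.Ioo r t | x ⊔ a < t} x = Set.Ioo r x := by
      ext y
      refine ⟨fun ⟨⟨hy, _⟩, hyx⟩ => ⟨hy.1, hyx.resolve_right fun h => (hcov hx hxa).2 h hy.2⟩,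
        fun hy => ⟨⟨⟨hy.1, hy.2.trans hx.2⟩, ?_⟩, .inl hy.2⟩⟩
      exact (sup_le (hy.2.trans hx.2).le hat.le).lt_of_ne fun h =>
        (hcov ⟨hy.1, hy.2.trans hx.2⟩ h).2 hy.2 hx.2
    rw [hlink]
    have := hρ x t (hcov hx hxa)
    exact (ih x hx.2 hx.1.le).mono (by omega)

section PartitionLattice

variable {α : Type*}

/-- The equivalence relation obtained from `r` by merging the classes of `x` and `y`. -/
def mergeClasses (r : Setoid α) (x y : α) : Setoid α where
  r z w := r z w ∨ r z x ∧ r y w ∨ r z y ∧ r x w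
  iseqv :=
    { refl := fun z => .inl (r.refl z)
      symm := by
        rintro z w (h | ⟨h₁, h₂⟩ | ⟨h₁, h₂⟩)
        exacts [.inl (r.symm h), .inr (.inr ⟨r.symm h₂, r.symm h₁⟩),
          .inr (.inl ⟨r.symm h₂, r.symm h₁⟩)]
      trans := by
        have hsymm : ∀ {a b}, r a b → r b a := r.symm
        have htrans : ∀ {a b c}, r a b → r b c → r a c := r.trans
        grind }

theorem mergeClasses_le_iff {r s : Setoid α} {x y : α} :
    mergeClasses r x y ≤ s ↔ r ≤ s ∧ s x y := by
  refine ⟨fun h => ⟨fun z w hzw => h (.inl hzw), h (.inr (.inl ⟨r.refl x, r.refl y⟩))⟩, ?_⟩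
  rintro ⟨hrs, hxy⟩ z w (h | ⟨h₁, h₂⟩ | ⟨h₁, h₂⟩)
  exacts [hrs h, s.trans (hrs h₁) (s.trans hxy (hrs h₂)),
    s.trans (hrs h₁) (s.trans (s.symm hxy) (hrs h₂))]

theorem covBy_mergeClasses {r : Setoid α} {x y : α} (hxy : ¬ r x y) :
    r ⋖ mergeClasses r x y := by
  obtain ⟨hle, hmem⟩ := mergeClasses_le_iff.1 (le_refl (mergeClasses r x y))
  refine ⟨hle.lt_of_not_ge fun h => hxy (h hmem), fun s hrs hs => ?_⟩
  obtain ⟨z, w, hzw, hnzw⟩ : ∃ z w, s z w ∧ ¬ r z w := by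
    simpa [Setoid.le_def] using hrs.not_ge
  refine hs.not_ge (mergeClasses_le_iff.2 ⟨hrs.le, ?_⟩)
  obtain h | ⟨h₁, h₂⟩ | ⟨h₁, h₂⟩ := hs.le hzw
  · exact absurd h hnzw
  · exact s.trans (hrs.le (r.symm h₁)) (s.trans hzw (hrs.le (r.symm h₂)))
  · exact s.trans (hrs.le h₂) (s.trans (s.symm hzw) (hrs.le h₁))

theorem exists_eq_mergeClasses_of_covBy {r s : Setoid α} (h : r ⋖ s) :
    ∃ x y, ¬ r x y ∧ s = mergeClasses r x y := by
  obtain ⟨x, y, hxy, hnxy⟩ : ∃ x y, s x y ∧ ¬ r x y := by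
    simpa [Setoid.le_def] using h.lt.not_ge
  have hle : mergeClasses r x y ≤ s := mergeClasses_le_iff.2 ⟨h.le, hxy⟩
  exact ⟨x, y, hnxy, ((h.eq_or_eq (covBy_mergeClasses hnxy).le hle).resolve_left
    (covBy_mergeClasses hnxy).ne').symm⟩

instance : IsUpperModularLattice (Setoid α) where
  covBy_sup_of_inf_covBy {a b} h := by
    obtain ⟨x, y, hxy, ha⟩ := exists_eq_mergeClasses_of_covBy h
    obtain ⟨-, haxy⟩ := mergeClasses_le_iff.1 ha.ge
    have hsup : a ⊔ b = mergeClasses b x y := by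
      refine le_antisymm (sup_le ?_ (mergeClasses_le_iff.1 le_rfl).1)
        (mergeClasses_le_iff.2 ⟨le_sup_right, (le_sup_left : a ≤ a ⊔ b) haxy⟩)
      obtain ⟨hle, hmem⟩ := mergeClasses_le_iff.1 (le_refl (mergeClasses b x y))
      exact ha.trans_le (mergeClasses_le_iff.2 ⟨inf_le_right.trans hle, hmem⟩)
    exact hsup ▸ covBy_mergeClasses fun hb => hxy ⟨haxy, hb⟩

instance [Finite α] : Finite (Setoid α) :=
  Finite.of_injective (fun r : Setoid α => (r : α → α → Prop)) fun _ _ h =>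
    Setoid.ext fun x y => iff_of_eq (congrFun₂ h x y)

theorem card_quotient_lt_of_lt [Finite α] {r s : Setoid α} (h : r < s) :
    Nat.card (Quotient s) < Nat.card (Quotient r) := by
  have hsurj : Function.Surjective (Quotient.map id h.le : Quotient r → Quotient s) :=
    Quotient.ind fun x => ⟨⟦x⟧, rfl⟩
  refine (Nat.card_le_card_of_surjective _ hsurj).lt_of_ne fun hcard => h.not_ge fun x y hxy => ?_
  have hinj := (hsurj.bijective_of_nat_card_le hcard.ge).injective
  exact Quotient.exact (hinj (a₁ := ⟦x⟧) (a₂ := ⟦y⟧) (Quotient.sound hxy))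

theorem card_quotient_le_card_quotient_mergeClasses_add_one [Finite α] (r : Setoid α) (x y : α) :
    Nat.card (Quotient r) ≤ Nat.card (Quotient (mergeClasses r x y)) + 1 := by
  classical
  rw [← Finite.card_option]
  refine Nat.card_le_card_of_injective (fun q => if q = ⟦y⟧ then none else
    some (Quotient.map id (mergeClasses_le_iff.1 le_rfl).1 q)) ?_
  refine Quotient.ind fun z => Quotient.ind fun w h => ?_
  simp only [Quotient.eq] at h
  split_ifs at h with hz hw hw
  · exact Quotient.sound (r.trans hz (r.symm hw))
  · obtain h | ⟨-, h⟩ | ⟨h, -⟩ := Quotient.exact (Option.some.inj h)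
    exacts [Quotient.sound h, absurd (r.symm h) hw, absurd h hz]

/-- The rank of a partition in the partition lattice: the number of elements minus the number of
classes. -/
noncomputable def partitionRank (r : Setoid α) : ℕ :=
  Nat.card α - Nat.card (Quotient r)

theorem card_quotient_le [Finite α] (r : Setoid α) : Nat.card (Quotient r) ≤ Nat.card α :=
  Nat.card_le_card_of_surjective _ Quotient.mk_surjective

theorem partitionRank_strictMono [Finite α] : StrictMono (partitionRank (α := α)) :=
  fun r s h => by
    have := card_quotient_lt_of_lt h
    have := card_quotient_le r
    unfold partitionRank
    omega

theorem partitionRank_le_of_covBy [Finite α] {r s : Setoid α} (h : r ⋖ s) :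
    partitionRank s ≤ partitionRank r + 1 := by
  obtain ⟨x, y, -, rfl⟩ := exists_eq_mergeClasses_of_covBy h
  have := card_quotient_le_card_quotient_mergeClasses_add_one r x y
  unfold partitionRank
  omega

theorem partitionRank_bot : partitionRank (⊥ : Setoid α) = 0 := by
  rw [partitionRank, ← Nat.card_congr (Equiv.ofBijective (Quotient.mk (⊥ : Setoid α))
    ⟨fun x y h => Quotient.exact h, Quotient.mk_surjective⟩), Nat.sub_self]

theorem partitionRank_top [Nonempty α] : partitionRank (⊤ : Setoid α) = Nat.card α - 1 := by
  have : Subsingleton (Quotient (⊤ : Setoid α)) :=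
    ⟨Quotient.ind₂ fun _ _ => Quotient.sound trivial⟩
  rw [partitionRank, Nat.card_of_subsingleton ⟦Classical.arbitrary α⟧]

end PartitionLattice

section Transfer

variable {Q P : Type} [PartialOrder Q] [PartialOrder P]

/-- The map on chains induced by an order embedding. -/
noncomputable def mapChains (e : Q ↪o P) (k : ℕ) : OrderChains Q k →ₗ[ℂ] OrderChains P k :=
  Finsupp.lmapDomain ℂ ℂ fun c => c.trans e

theorem mapChains_injective (e : Q ↪o P) (k : ℕ) : Function.Injective (mapChains e k) :=
  Finsupp.mapDomain_injective fun _ _ h =>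
    RelEmbedding.ext fun i => e.injective (DFunLike.congr_fun h i)

theorem orderBoundary_mapChains (e : Q ↪o P) (k : ℕ) (z : OrderChains Q (k + 1)) :
    orderBoundary P k (mapChains e (k + 1) z) = mapChains e k (orderBoundary Q k z) := by
  have h : orderBoundary P k ∘ₗ mapChains e (k + 1) = mapChains e k ∘ₗ orderBoundary Q k := by
    ext c : 2
    simp only [mapChains, LinearMap.comp_apply, Finsupp.lsingle_apply, Finsupp.lmapDomain_apply,
      Finsupp.mapDomain_single, orderBoundary_single, Finsupp.mapDomain_finsetSum]
    rfl
  exact LinearMap.congr_fun h z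

theorem mapChains_mem_orderCycles (e : Q ↪o P) {k : ℕ} {z : OrderChains Q k}
    (hz : z ∈ orderCycles Q k) : mapChains e k z ∈ orderCycles P k := by
  cases k with
  | zero => exact Submodule.mem_top
  | succ k =>
    have hz : orderBoundary Q k z = 0 := hz
    change orderBoundary P k _ = 0
    rw [orderBoundary_mapChains, hz, map_zero]

theorem range_mapChains (e : Q ↪o P) (k : ℕ) :
    LinearMap.range (mapChains e k) = chainsIn (Set.range e) k := by
  refine le_antisymm ?_ (chainsIn_le_iff.2 fun c hc => ?_)
  · rw [LinearMap.range_eq_map, ← Finsupp.supported_univ, mapChains, Finsupp.lmapDomain_supported]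
    rintro z hz
    refine mem_chainsIn.2 fun c hc i => ?_
    obtain ⟨d, -, rfl⟩ := hz (Finsupp.mem_support_iff.2 hc)
    exact ⟨d i, rfl⟩
  · choose d hd using hc
    let d' : Fin k ↪o Q := OrderEmbedding.ofMapLEIff d fun i j => by
      rw [← e.le_iff_le, hd, hd, c.le_iff_le]
    refine ⟨Finsupp.single d' 1, ?_⟩
    rw [mapChains, Finsupp.lmapDomain_apply, Finsupp.mapDomain_single]
    exact congrArg (Finsupp.single · 1) (RelEmbedding.ext hd)

theorem AcyclicBelow.orderCycles_le (e : Q ↪o P) {m : ℕ} (h : AcyclicBelow (Set.range e) m)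
    {k : ℕ} (hk : k < m) : orderCycles Q k ≤ orderBoundaries Q k := by
  intro z hz
  obtain ⟨w, hw, hwz⟩ := h k hk _ (range_mapChains e k ▸ LinearMap.mem_range_self _ z)
    (mapChains_mem_orderCycles e hz)
  obtain ⟨w, rfl⟩ := (range_mapChains e (k + 1)).ge hw
  exact ⟨w, mapChains_injective e k (by rw [← orderBoundary_mapChains, hwz])⟩

end Transfer

section ProperPart

variable {P : Type}

theorem range_subtype_properPart [PartialOrder P] [BoundedOrder P] :
    Set.range (OrderEmbedding.subtype fun x : P => x ≠ ⊥ ∧ x ≠ ⊤) = Set.Ioo ⊥ ⊤ := by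
  ext x
  simp [bot_lt_iff_ne_bot, lt_top_iff_ne_top]

theorem orderCycles_properPart_le [Lattice P] [BoundedOrder P] [IsUpperModularLattice P] [Finite P]
    {ρ : P → ℕ} (hρ : ∀ a b, a ⋖ b → ρ b ≤ ρ a + 1) {k : ℕ} (hk : k < ρ ⊤ - ρ ⊥ - 1) :
    orderCycles (ProperPart P) k ≤ orderBoundaries (ProperPart P) k :=
  AcyclicBelow.orderCycles_le (OrderEmbedding.subtype _)
    (range_subtype_properPart (P := P) ▸ acyclicBelow_Ioo hρ bot_le) hk

theorem length_le_of_properPart_chain [PartialOrder P] [BoundedOrder P] {ρ : P → ℕ}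
    (hρ : StrictMono ρ) {k : ℕ} (c : Fin k ↪o ProperPart P) : k ≤ ρ ⊤ - ρ ⊥ - 1 := by
  have hmem : ∀ i, ρ (c i) ∈ Finset.Ioo (ρ ⊥) (ρ ⊤) := fun i =>
    Finset.mem_Ioo.2 ⟨hρ (bot_lt_iff_ne_bot.2 (c i).2.1), hρ (lt_top_iff_ne_top.2 (c i).2.2)⟩
  have hmono : StrictMono fun i => ρ (c i) := fun i j hij => hρ (c.strictMono hij)
  simpa using Finset.card_le_card_of_injOn (s := Finset.univ) _ (fun i _ => hmem i)
    hmono.injective.injOn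

end ProperPart

section HopfTrace

theorem character_subquotientRep_bot {G V : Type} [Group G] [AddCommGroup V] [Module ℂ V]
    [FiniteDimensional ℂ V] {ρ : Representation ℂ G V} {Z B : Submodule ℂ V}
    (hZ : ∀ g, Z ≤ Z.comap (ρ g)) (hB : ∀ g, B ≤ B.comap (ρ g)) (h : B = ⊥) (g : G) :
    (subquotientRep ρ Z B hZ hB).character g = LinearMap.trace ℂ Z ((ρ g).restrict (hZ g)) := by
  have hker : LinearMap.ker (B.submoduleOf Z).mkQ = ⊥ := by
    rw [Submodule.ker_mkQ, Submodule.submoduleOf, h, Submodule.comap_bot, Submodule.ker_subtype]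
  have htrace := trace_eq_trace_restrict_ker_add (B.submoduleOf Z).mkQ (Submodule.mkQ_surjective _)
    ((ρ g).restrict (hZ g)) (subquotientRep ρ Z B hZ hB g) rfl hker (by simp)
  rw [htrace, Subsingleton.elim (LinearMap.restrict _ _) 0, map_zero, zero_add]
  rfl

variable {Q : Type} [PartialOrder Q] [Finite Q]

instance (k : ℕ) : Finite (Fin k ↪o Q) :=
  Finite.of_injective _ DFunLike.coe_injective

variable {G : Type} [Group G] (α : G →* (Q ≃o Q)) (g : G)

theorem trace_orderChainsRep (k : ℕ) : LinearMap.trace ℂ _ (orderChainsRep α k g) =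
    Nat.card {c : Fin k ↪o Q // c.trans (α g).toOrderEmbedding = c} :=
  trace_lmapDomain ℂ _

theorem trace_orderChainsRep_succ {k : ℕ} (hk : orderCycles Q k ≤ orderBoundaries Q k) :
    LinearMap.trace ℂ _ (orderChainsRep α (k + 1) g) =
      LinearMap.trace ℂ _
        ((orderChainsRep α (k + 1) g).restrict (orderCycles_invariant α (k + 1) g)) +
      LinearMap.trace ℂ _ ((orderChainsRep α k g).restrict (orderCycles_invariant α k g)) := by
  have hboundary : ∀ z, orderBoundary Q k z ∈ orderCycles Q k := fun z => by
    cases k with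
    | zero => exact Submodule.mem_top
    | succ k => exact LinearMap.congr_fun (orderBoundary_orderBoundary Q k) z
  let f : OrderChains Q (k + 1) →ₗ[ℂ] orderCycles Q k :=
    LinearMap.codRestrict _ (orderBoundary Q k) hboundary
  have hf : Function.Surjective f := fun ⟨z, hz⟩ => (hk hz).imp fun w hw => Subtype.ext hw
  have hcomm : f ∘ₗ orderChainsRep α (k + 1) g =
      (orderChainsRep α k g).restrict (orderCycles_invariant α k g) ∘ₗ f :=
    LinearMap.ext fun z => Subtype.ext (orderBoundary_orderChainsRep α k g z)
  have hker : LinearMap.ker f = orderCycles Q (k + 1) := LinearMap.ker_codRestrict _ _ _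
  exact trace_eq_trace_restrict_ker_add (k := ℂ) (V := OrderChains Q (k + 1))
    (W := orderCycles Q k) f hf _ _ hcomm hker (orderCycles_invariant α (k + 1) g)

theorem trace_restrict_orderCycles {K : ℕ} (hK : ∀ k < K, orderCycles Q k ≤ orderBoundaries Q k) :
    LinearMap.trace ℂ _ ((orderChainsRep α K g).restrict (orderCycles_invariant α K g)) =
      ∑ k ∈ Finset.range (K + 1), (-1) ^ (K + k) *
        (Nat.card {c : Fin k ↪o Q // c.trans (α g).toOrderEmbedding = c} : ℂ) := by
  induction K with
  | zero =>
    rw [Finset.sum_range_one, ← trace_orderChainsRep, pow_zero, one_mul,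
      ← LinearMap.trace_conj' (R := ℂ) (M := orderCycles Q 0) (N := OrderChains Q 0) _
        (LinearEquiv.ofTop (orderCycles Q 0) rfl)]
    rfl
  | succ K ih =>
    have htrace := trace_orderChainsRep_succ α g (hK K K.lt_succ_self)
    rw [ih fun k hk => hK k (hk.trans K.lt_succ_self), trace_orderChainsRep] at htrace
    have hsign : ∀ k, (-1 : ℂ) ^ (K + 1 + k) = -(-1) ^ (K + k) := fun k => by ring
    rw [Finset.sum_range_succ, eq_sub_of_add_eq htrace.symm]
    simp only [hsign, neg_mul, Finset.sum_neg_distrib, ← two_mul, pow_mul, pow_succ]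
    ring

theorem character_orderHomology {K : ℕ} (hK : ∀ k < K, orderCycles Q k ≤ orderBoundaries Q k)
    (htop : IsEmpty (Fin (K + 1) ↪o Q)) :
    (orderHomology α K).ρ.character g =
      ∑ k ∈ Finset.range (K + 1), (-1) ^ (K + k) *
        (Nat.card {c : Fin k ↪o Q // c.trans (α g).toOrderEmbedding = c} : ℂ) := by
  rw [← trace_restrict_orderCycles α g hK]
  refine character_subquotientRep_bot (orderCycles_invariant α K) (orderBoundaries_invariant α K)
    (LinearMap.range_eq_bot.2 <| LinearMap.ext fun z => ?_) g
  rw [Subsingleton.elim z 0, map_zero, map_zero]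

end HopfTrace

section PhilipHall

variable {F : Type*} [PartialOrder F]

/-- The number of chains `c₀ < ⋯ < c_{k-1}` in the open interval between `a` and `b`, the numbers
that express the Möbius function in Philip Hall's theorem. -/
noncomputable def chainCount (k : ℕ) (a b : F) : ℕ :=
  Nat.card {c : Fin k ↪o F // ∀ i, c i ∈ Set.Ioo a b}

theorem chainCount_zero (a b : F) : chainCount 0 a b = 1 := by
  rw [chainCount, Nat.card_eq_one_iff_unique]
  exact ⟨⟨fun c d => Subtype.ext (DFunLike.ext _ _ fun i => i.elim0)⟩,
    ⟨⟨OrderEmbedding.ofIsEmpty, fun i => i.elim0⟩⟩⟩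

/-- The chain obtained from a chain by adding a new greatest element. -/
def snocChain {k : ℕ} (c : Fin k ↪o F) (s : F) (hs : ∀ i, c i < s) : Fin (k + 1) ↪o F :=
  OrderEmbedding.ofStrictMono (Fin.snoc (α := fun _ => F) c s) fun i j hij => by
    obtain ⟨i, rfl⟩ := i.exists_castSucc_eq.2 (Fin.ne_last_of_lt hij)
    rw [Fin.snoc_castSucc]
    induction j using Fin.lastCases with
    | last => rw [Fin.snoc_last]; exact hs i
    | cast j => rw [Fin.snoc_castSucc]; exact c.strictMono (Fin.castSucc_lt_castSucc_iff.1 hij)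

theorem snocChain_last {k : ℕ} (c : Fin k ↪o F) (s : F) (hs : ∀ i, c i < s) :
    snocChain c s hs (Fin.last k) = s :=
  Fin.snoc_last (α := fun _ => F) s c

theorem snocChain_castSucc {k : ℕ} (c : Fin k ↪o F) (s : F) (hs : ∀ i, c i < s) (i : Fin k) :
    snocChain c s hs i.castSucc = c i :=
  Fin.snoc_castSucc (α := fun _ => F) s c i

/-- Splitting a nonempty chain in an open interval into its greatest element and the chain of the
other elements. -/
def chainSuccEquiv (k : ℕ) (a b : F) : {c : Fin (k + 1) ↪o F // ∀ i, c i ∈ Set.Ioo a b} ≃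
    Σ s : Set.Ioo a b, {c : Fin k ↪o F // ∀ i, c i ∈ Set.Ioo a (s : F)} where
  toFun c := ⟨⟨c.1 (Fin.last k), c.2 _⟩, Fin.castSuccOrderEmb.trans c.1, fun i =>
    ⟨(c.2 _).1, c.1.strictMono (Fin.castSucc_lt_last i)⟩⟩
  invFun p := ⟨snocChain p.2.1 p.1 fun i => (p.2.2 i).2, Fin.lastCases
    (by rw [snocChain_last]; exact p.1.2)
    fun i => by rw [snocChain_castSucc]; exact ⟨(p.2.2 i).1, (p.2.2 i).2.trans p.1.2.2⟩⟩
  left_inv c := by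
    have hlt : ∀ i : Fin k, c.1 i.castSucc < c.1 (Fin.last k) := fun i =>
      c.1.strictMono (Fin.castSucc_lt_last i)
    exact Subtype.ext <| DFunLike.ext _ _ <| Fin.lastCases (snocChain_last _ _ hlt) <|
      snocChain_castSucc (Fin.castSuccOrderEmb.trans c.1) _ hlt
  right_inv p := by
    obtain ⟨⟨s, hs⟩, c, hc⟩ := p
    exact Sigma.subtype_ext (Subtype.ext (snocChain_last c s fun i => (hc i).2))
      (DFunLike.ext _ _ (snocChain_castSucc c s fun i => (hc i).2))

variable [LocallyFiniteOrder F]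

theorem chainCount_succ (k : ℕ) (a b : F) :
    chainCount (k + 1) a b = ∑ s ∈ Finset.Ioo a b, chainCount k a s := by
  have hfinite : ∀ s : F, Finite {c : Fin k ↪o F // ∀ i, c i ∈ Set.Ioo a s} := fun s =>
    have := (Set.finite_Ioo a s).to_subtype
    Finite.of_injective (fun c i => (⟨c.1 i, c.2 i⟩ : Set.Ioo a s)) fun c d h =>
      Subtype.ext (DFunLike.ext _ _ fun i => congrArg Subtype.val (congrFun h i))
  have := Fintype.ofFinite (Set.Ioo a b)
  rw [chainCount, Nat.card_congr (chainSuccEquiv k a b), Nat.card_sigma]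
  exact (Finset.sum_subtype _ (fun s => Finset.mem_Ioo.trans Set.mem_Ioo.symm) fun s =>
    chainCount k a s).symm

theorem mu_eq_sum_chainCount (R : Type*) [Ring R] [DecidableEq F] {a b : F} (hab : a < b) {N : ℕ}
    (hN : chainCount N a b = 0) :
    IncidenceAlgebra.mu R a b = ∑ k ∈ Finset.range N, (-1) ^ (k + 1) * (chainCount k a b : R) := by
  induction N generalizing b with
  | zero => simp [chainCount_zero] at hN
  | succ N ih =>
    rw [chainCount_succ, Finset.sum_eq_zero_iff] at hN
    have hmu : ∀ s ∈ Finset.Ioo a b, IncidenceAlgebra.mu R a s =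
        ∑ k ∈ Finset.range N, (-1) ^ (k + 1) * (chainCount k a s : R) := fun s hs =>
      ih (Finset.mem_Ioo.1 hs).1 (hN s hs)
    rw [IncidenceAlgebra.mu_eq_neg_sum_Ico_of_ne hab.ne, ← Finset.Ioo_insert_left hab,
      Finset.sum_insert Finset.left_notMem_Ioo, IncidenceAlgebra.mu_self, Finset.sum_congr rfl hmu,
      Finset.sum_comm, Finset.sum_range_succ', neg_add_rev]
    simp [chainCount_zero, chainCount_succ, ← Finset.mul_sum, pow_succ]

end PhilipHall

section FixedChains

variable {G P F : Type} [Group G] [PartialOrder P] [BoundedOrder P] [PartialOrder F]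
  [BoundedOrder F] (α : G →* (P ≃o P)) (g : G) (ι : F ↪o P)

theorem map_bot_and_map_top_of_range_eq_fixed (hι : ∀ x, x ∈ Set.range ι ↔ α g x = x) :
    ι ⊥ = ⊥ ∧ ι ⊤ = ⊤ := by
  obtain ⟨b, hb⟩ := (hι ⊥).2 (map_bot _)
  obtain ⟨t, ht⟩ := (hι ⊤).2 (map_top _)
  exact ⟨le_bot_iff.1 (hb ▸ ι.monotone bot_le), top_le_iff.1 (ht ▸ ι.monotone le_top)⟩

theorem card_fixed_properPart_chains (hι : ∀ x, x ∈ Set.range ι ↔ α g x = x) (k : ℕ) :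
    Nat.card {c : Fin k ↪o ProperPart P // c.trans (properPartAction α g).toOrderEmbedding = c} =
      chainCount k (⊥ : F) ⊤ := by
  obtain ⟨hbot, htop⟩ := map_bot_and_map_top_of_range_eq_fixed α g ι hι
  let toFixed : {c : Fin k ↪o F // ∀ i, c i ∈ Set.Ioo ⊥ ⊤} →
      {c : Fin k ↪o ProperPart P // c.trans (properPartAction α g).toOrderEmbedding = c} := fun c =>
    ⟨OrderEmbedding.ofMapLEIff (fun i => (⟨ι (c.1 i),
        fun h => (c.2 i).1.ne' (ι.injective (h.trans hbot.symm)),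
        fun h => (c.2 i).2.ne (ι.injective (h.trans htop.symm))⟩ : ProperPart P))
        fun i j => (ι.le_iff_le).trans c.1.le_iff_le,
      DFunLike.ext _ _ fun i => Subtype.ext ((hι _).1 ⟨c.1 i, rfl⟩)⟩
  refine (Nat.card_eq_of_bijective toFixed ⟨fun c d h => ?_, fun ⟨c, hc⟩ => ?_⟩).symm
  · refine Subtype.ext (DFunLike.ext _ _ fun i => ι.injective ?_)
    exact congrArg Subtype.val (DFunLike.congr_fun (congrArg Subtype.val h) i)
  · have hfixed : ∀ i, (c i : P) ∈ Set.range ι := fun i =>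
      (hι _).2 (congrArg Subtype.val (DFunLike.congr_fun hc i))
    choose d hd using hfixed
    refine ⟨⟨OrderEmbedding.ofMapLEIff d fun i j => ?_, fun i => ⟨?_, ?_⟩⟩, ?_⟩
    · rw [← ι.le_iff_le, hd, hd, Subtype.coe_le_coe, c.le_iff_le]
    · exact bot_lt_iff_ne_bot.2 fun h => (c i).2.1 ((hd i).symm.trans ((congrArg ι h).trans hbot))
    · exact lt_top_iff_ne_top.2 fun h => (c i).2.2 ((hd i).symm.trans ((congrArg ι h).trans htop))
    · exact Subtype.ext (DFunLike.ext _ _ fun i => Subtype.ext (hd i))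

end FixedChains

section HomologyCharacter

variable {G P F : Type} [Group G] [Lattice P] [BoundedOrder P] [IsUpperModularLattice P] [Finite P]
  [PartialOrder F] [BoundedOrder F] [LocallyFiniteOrder F] [DecidableEq F]

theorem character_orderHomology_properPart {ρ : P → ℕ} (hρ : ∀ a b, a ⋖ b → ρ b ≤ ρ a + 1)
    (hρ' : StrictMono ρ) (h : (⊥ : P) ≠ ⊤) (α : G →* (P ≃o P)) (g : G) (ι : F ↪o P)
    (hι : ∀ x, x ∈ Set.range ι ↔ α g x = x) :
    (orderHomology (properPartAction α) (ρ ⊤ - ρ ⊥ - 1)).ρ.character g =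
      (-1) ^ (ρ ⊤ - ρ ⊥) * IncidenceAlgebra.mu ℂ (⊥ : F) ⊤ := by
  obtain ⟨hbot, htop⟩ := map_bot_and_map_top_of_range_eq_fixed α g ι hι
  obtain ⟨K, hK⟩ : ∃ K, ρ ⊤ - ρ ⊥ = K + 1 :=
    Nat.exists_eq_succ_of_ne_zero (Nat.sub_ne_zero_of_lt (hρ' (bot_lt_iff_ne_bot.2 h.symm)))
  have hlength : IsEmpty (Fin (K + 1) ↪o ProperPart P) := ⟨fun c => by
    have := length_le_of_properPart_chain hρ' c
    omega⟩
  have hzero : chainCount (K + 1) (⊥ : F) ⊤ = 0 := by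
    rw [← card_fixed_properPart_chains α g ι hι, Nat.card_eq_zero]
    exact Or.inl inferInstance
  have hlt : (⊥ : F) < ⊤ := bot_lt_iff_ne_bot.2 fun h' => h (by rw [← hbot, ← htop, h'])
  rw [hK, Nat.add_sub_cancel, character_orderHomology _ g
    (fun k hk => orderCycles_properPart_le hρ (by omega)) hlength,
    mu_eq_sum_chainCount ℂ hlt hzero, Finset.mul_sum]
  refine Finset.sum_congr rfl fun k _ => ?_
  rw [card_fixed_properPart_chains α g ι hι, ← mul_assoc, ← pow_add]
  congr 1
  ring

end HomologyCharacter

section ProperPartHomology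

variable {P : Type} [PartialOrder P] [BoundedOrder P] {G : Type} [Group G] (α : G →* (P ≃o P))

theorem properPartHomology_of_bot_eq_top (h : (⊥ : P) = ⊤) :
    properPartHomology α (-2) = Rep.trivial ℂ G ℂ := by
  rw [properPartHomology, if_pos h, if_pos rfl]

theorem properPartHomology_of_bot_ne_top (h : (⊥ : P) ≠ ⊤) (k : ℕ) :
    properPartHomology α (k - 1) = orderHomology (properPartAction α) k := by
  rw [properPartHomology, if_neg h, if_pos (by omega), sub_add_cancel, Int.toNat_natCast]

theorem finiteDimensional_subquotientRep {V : Type} [AddCommGroup V] [Module ℂ V]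
    [FiniteDimensional ℂ V] {ρ : Representation ℂ G V} {Z B : Submodule ℂ V}
    (hZ : ∀ g, Z ≤ Z.comap (ρ g)) (hB : ∀ g, B ≤ B.comap (ρ g)) :
    FiniteDimensional ℂ (Rep.of (subquotientRep ρ Z B hZ hB)) :=
  inferInstanceAs (FiniteDimensional ℂ (Z ⧸ B.submoduleOf Z))

theorem finiteDimensional_properPartHomology [Finite P] (j : ℤ) :
    FiniteDimensional ℂ (properPartHomology α j) := by
  generalize hA : properPartHomology α j = A
  rw [properPartHomology] at hA
  split_ifs at hA <;> subst hA
  · exact inferInstanceAs (FiniteDimensional ℂ ℂ)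
  · exact inferInstanceAs (FiniteDimensional ℂ PUnit)
  · exact finiteDimensional_subquotientRep (orderCycles_invariant _ _)
      (orderBoundaries_invariant _ _)
  · exact inferInstanceAs (FiniteDimensional ℂ PUnit)

theorem character_properPartHomology {P F : Type} [Lattice P] [BoundedOrder P]
    [IsUpperModularLattice P] [Finite P] [PartialOrder F] [BoundedOrder F] [LocallyFiniteOrder F]
    [DecidableEq F] {ρ : P → ℕ} (hρ : ∀ a b, a ⋖ b → ρ b ≤ ρ a + 1) (hρ' : StrictMono ρ)
    (α : G →* (P ≃o P)) (g : G) (ι : F ↪o P) (hι : ∀ x, x ∈ Set.range ι ↔ α g x = x) :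
    (properPartHomology α (ρ ⊤ - ρ ⊥ - 2)).ρ.character g =
      (-1) ^ (ρ ⊤ - ρ ⊥) * IncidenceAlgebra.mu ℂ (⊥ : F) ⊤ := by
  by_cases h : (⊥ : P) = ⊤
  · obtain ⟨hbot, htop⟩ := map_bot_and_map_top_of_range_eq_fixed α g ι hι
    have hF : (⊥ : F) = ⊤ := ι.injective (by rw [hbot, htop, h])
    rw [← h, sub_self, zero_sub, properPartHomology_of_bot_eq_top α h, Nat.sub_self, pow_zero,
      one_mul, ← hF, IncidenceAlgebra.mu_self]
    exact (LinearMap.trace_one ℂ ℂ).trans (by rw [Module.finrank_self, Nat.cast_one])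
  · have hlt : ρ ⊥ < ρ ⊤ := hρ' (bot_lt_iff_ne_bot.2 (Ne.symm h))
    have hdegree : (ρ ⊤ - ρ ⊥ - 2 : ℤ) = (ρ ⊤ - ρ ⊥ - 1 : ℕ) - 1 := by omega
    rw [hdegree, properPartHomology_of_bot_ne_top α h,
      character_orderHomology_properPart hρ hρ' h α g ι hι]

end ProperPartHomology

section EquivariantMaps

open Function Equiv.Perm

variable {α β : Type*}

theorem semiconj_zpow {f : α → β} {g : Equiv.Perm α} {h : Equiv.Perm β} (hf : Semiconj f g h)
    (i : ℤ) : Semiconj f (g ^ i : Equiv.Perm α) (h ^ i : Equiv.Perm β) := by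
  cases i with
  | ofNat n =>
    simp only [Int.ofNat_eq_natCast, zpow_natCast, Equiv.Perm.coe_pow]
    exact hf.iterate_right n
  | negSucc n =>
    simp only [zpow_negSucc]
    refine Semiconj.inverses_right ?_ (g ^ (n + 1)).apply_symm_apply (h ^ (n + 1)).symm_apply_apply
    simpa only [Equiv.Perm.coe_pow] using hf.iterate_right (n + 1)

theorem sameCycle_setoid_le_ker_iff {g : Equiv.Perm α} {f : α → β} :
    SameCycle.setoid g ≤ Setoid.ker f ↔ ∀ x, f (g x) = f x := by
  refine ⟨fun h x => h (sameCycle_apply_left.2 (SameCycle.refl g x)), ?_⟩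
  rintro h x _ ⟨i, rfl⟩
  have hf := semiconj_zpow (h := 1) h i x
  rw [one_zpow] at hf
  exact hf.symm

theorem zpow_apply_eq_self_iff_minimalPeriod_dvd {g : Equiv.Perm α} {x : α} {i : ℤ} :
    (g ^ i) x = x ↔ (minimalPeriod g x : ℤ) ∣ i :=
  MulAction.zpow_smul_eq_iff_minimalPeriod_dvd (a := g) (b := x)

theorem minimalPeriod_eq_of_semiconj {f : α → β} (hf : Injective f) {g : α → α} {h : β → β}
    (hfgh : Semiconj f g h) (x : α) : minimalPeriod g x = minimalPeriod h (f x) :=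
  minimalPeriod_eq_minimalPeriod_iff.2 fun n => by
    rw [IsPeriodicPt, IsPeriodicPt, IsFixedPt, IsFixedPt, ← (hfgh.iterate_right n).eq, hf.eq_iff]

theorem exists_semiconj_mul_left {C : Type*} [Group C] {g : Equiv.Perm α} {h : C}
    (hgh : ∀ x (i : ℤ), (g ^ i) x = x → h ^ i = 1) : ∃ f : α → C, Semiconj f g (h * ·) := by
  let s : α → α := fun x => (Quotient.mk (SameCycle.setoid g) x).out
  have hs : ∀ x, ∃ i : ℤ, (g ^ i) (s x) = x := fun x =>
    Quotient.exact (Quotient.out_eq (Quotient.mk (SameCycle.setoid g) x))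
  have hsg : ∀ x, s (g x) = s x := fun x => congrArg Quotient.out <|
    Quotient.sound (sameCycle_apply_left.2 (SameCycle.refl g x))
  choose i hi using hs
  refine ⟨fun x => h ^ i x, fun x => ?_⟩
  have hfix : (g ^ (-(1 + i x) + i (g x))) (s x) = s x := by
    have hgx : (g ^ i (g x)) (s x) = g x := hsg x ▸ hi (g x)
    rw [zpow_add, mul_apply, hgx, zpow_neg, inv_eq_iff_eq, zpow_add, mul_apply, hi, zpow_one]
  have hone := hgh _ _ hfix
  rw [zpow_add, zpow_neg, inv_mul_eq_one, zpow_add, zpow_one] at hone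
  exact hone.symm

/-- The model of a permutation all of whose cycles have length `d`: the translation by `1` on
copies of `ZMod d`, one for each element of `O`. -/
def shiftPerm (O : Type*) (d : ℕ) : Equiv.Perm (O × ZMod d) :=
  Equiv.prodCongrRight fun _ => Equiv.addRight 1

theorem shiftPerm_zpow_apply {O : Type*} {d : ℕ} (i : ℤ) (p : O × ZMod d) :
    (shiftPerm O d ^ i) p = (p.1, p.2 + i) := by
  induction i generalizing p with
  | zero => simp
  | succ i ih =>
    rw [zpow_add, zpow_one, mul_apply, ih]
    simp [shiftPerm, add_comm, add_left_comm]
  | pred i ih =>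
    rw [zpow_sub, zpow_one, mul_apply, ih]
    simp [shiftPerm, Equiv.Perm.inv_def, sub_eq_add_neg, add_comm, add_left_comm]

theorem exists_equiv_semiconj_shiftPerm {g : Equiv.Perm α} {d : ℕ}
    (hg : ∀ x, minimalPeriod g x = d) :
    ∃ e : α ≃ Quotient (SameCycle.setoid g) × ZMod d, Semiconj e g (shiftPerm _ d) := by
  have hzpow : ∀ x (i : ℤ), (g ^ i) x = x ↔ (i : ZMod d) = 0 := fun x i => by
    rw [zpow_apply_eq_self_iff_minimalPeriod_dvd, hg, ZMod.intCast_zmod_eq_zero_iff_dvd]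
  obtain ⟨a, ha⟩ := exists_semiconj_mul_left (h := Multiplicative.ofAdd (1 : ZMod d))
    fun x i hi => by simpa [← ofAdd_zsmul] using (hzpow x i).1 hi
  let F : α → Quotient (SameCycle.setoid g) × ZMod d := fun x => (Quotient.mk _ x, (a x).toAdd)
  have hF : Semiconj F g (shiftPerm _ d) := fun x => Prod.ext
    (Quotient.sound (sameCycle_apply_left.2 (SameCycle.refl g x)))
    ((congrArg Multiplicative.toAdd (ha x)).trans (add_comm _ _))
  have hF_zpow : ∀ (i : ℤ) x, F ((g ^ i) x) = ((F x).1, (F x).2 + i) := fun i x =>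
    (semiconj_zpow hF i x).trans (shiftPerm_zpow_apply i _)
  refine ⟨Equiv.ofBijective F ⟨fun x y hxy => ?_, ?_⟩, hF⟩
  · obtain ⟨i, rfl⟩ : g.SameCycle x y := Quotient.exact (congrArg Prod.fst hxy)
    rw [hF_zpow, Prod.ext_iff, left_eq_add] at hxy
    exact ((hzpow x i).2 hxy.2).symm
  · rintro ⟨⟨x⟩, c⟩
    refine ⟨(g ^ (ZMod.cast (c - (F x).2) : ℤ)) x, (hF_zpow _ _).trans ?_⟩
    rw [ZMod.intCast_zmod_cast, add_sub_cancel]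
    rfl

theorem card_injective_semiconj_shiftPerm (O O' : Type*) (d : ℕ) :
    Nat.card {f : O × ZMod d → O' × ZMod d //
      Semiconj f (shiftPerm O d) (shiftPerm O' d) ∧ Injective f} =
      Nat.card (O → ZMod d) * Nat.card (O ↪ O') := by
  rw [← Nat.card_prod]
  let toMap : (O → ZMod d) × (O ↪ O') → {f : O × ZMod d → O' × ZMod d //
      Semiconj f (shiftPerm O d) (shiftPerm O' d) ∧ Injective f} := fun p =>
    ⟨fun x => (p.2 x.1, p.1 x.1 + x.2), fun x => Prod.ext rfl (add_assoc _ _ _).symm,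
      fun ⟨o, x⟩ ⟨o', x'⟩ h => by
        obtain rfl := p.2.injective (congrArg Prod.fst h)
        exact congrArg (Prod.mk o) (add_left_cancel (congrArg Prod.snd h))⟩
  refine (Nat.card_eq_of_bijective toMap ⟨fun p p' h => ?_, fun ⟨f, hf, hinj⟩ => ?_⟩).symm
  · have hzero : ∀ o, (p.2 o, p.1 o + 0) = (p'.2 o, p'.1 o + 0) := fun o =>
      congrFun (congrArg Subtype.val h) (o, 0)
    simp only [add_zero, Prod.ext_iff] at hzero
    exact Prod.ext (funext fun o => (hzero o).2) (DFunLike.ext _ _ fun o => (hzero o).1)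
  · have hf_apply : ∀ o x, f (o, x) = ((f (o, 0)).1, (f (o, 0)).2 + x) := fun o x => by
      have := semiconj_zpow hf (ZMod.cast x : ℤ) (o, 0)
      rwa [shiftPerm_zpow_apply, shiftPerm_zpow_apply, ZMod.intCast_zmod_cast, zero_add] at this
    refine ⟨(fun o => (f (o, 0)).2, ⟨fun o => (f (o, 0)).1, fun o o' h => ?_⟩),
      Subtype.ext (funext fun ⟨o, x⟩ => (hf_apply o x).symm)⟩
    refine congrArg Prod.fst (hinj (a₁ := (o, 0)) (a₂ := (o', (f (o, 0)).2 - (f (o', 0)).2)) ?_)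
    rw [hf_apply o', add_sub_cancel]
    exact Prod.ext h rfl

theorem card_quotient_sameCycle_mul {g : Equiv.Perm α} {d : ℕ} (hg : ∀ x, minimalPeriod g x = d) :
    Nat.card (Quotient (SameCycle.setoid g)) * d = Nat.card α := by
  obtain ⟨e, -⟩ := exists_equiv_semiconj_shiftPerm hg
  rw [Nat.card_congr e, Nat.card_prod, Nat.card_zmod]

theorem card_injective_semiconj [Finite α] [Finite β] {g : Equiv.Perm α} {h : Equiv.Perm β} {d : ℕ}
    [NeZero d] (hg : ∀ x, minimalPeriod g x = d) (hh : ∀ y, minimalPeriod h y = d) :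
    Nat.card {f : α → β // Semiconj f g h ∧ Injective f} =
      d ^ (Nat.card α / d) * (Nat.card β / d).descFactorial (Nat.card α / d) := by
  obtain ⟨e, he⟩ := exists_equiv_semiconj_shiftPerm hg
  obtain ⟨e', he'⟩ := exists_equiv_semiconj_shiftPerm hh
  have hconj : ∀ f : α → β, Semiconj f g h ∧ Injective f ↔
      Semiconj (e.arrowCongr e' f) (shiftPerm _ d) (shiftPerm _ d) ∧
        Injective (e.arrowCongr e' f) := fun f => by
    have hinj : Injective (e.arrowCongr e' f) ↔ Injective f := by
      simp [Equiv.arrowCongr]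
    have hsemi : Semiconj (e.arrowCongr e' f) (shiftPerm _ d) (shiftPerm _ d) ↔ Semiconj f g h := by
      refine e.surjective.forall.trans (forall_congr' fun x => ?_)
      rw [← he x]
      simp [← he' (f x)]
    rw [hinj, hsemi]
  have := Fintype.ofFinite (Quotient (SameCycle.setoid g))
  have := Fintype.ofFinite (Quotient (SameCycle.setoid h))
  rw [Nat.card_congr (Equiv.subtypeEquiv (q := fun f => Semiconj f (shiftPerm _ d) (shiftPerm _ d) ∧
    Injective f) (e.arrowCongr e') hconj), card_injective_semiconj_shiftPerm,
    Nat.card_fun, Nat.card_zmod, Nat.card_eq_fintype_card (α := _ ↪ _), Fintype.card_embedding_eq,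
    ← Nat.card_eq_fintype_card, ← Nat.card_eq_fintype_card,
    ← card_quotient_sameCycle_mul hg, ← card_quotient_sameCycle_mul hh,
    Nat.mul_div_cancel _ (NeZero.pos d), Nat.mul_div_cancel _ (NeZero.pos d)]

theorem sign_eq_of_minimalPeriod_eq [Fintype α] [DecidableEq α] {g : Equiv.Perm α} {d : ℕ}
    [NeZero d] (hg : ∀ x, minimalPeriod g x = d) :
    sign g = (-1) ^ (Nat.card α + Nat.card α / d) := by
  classical
  obtain ⟨e, he⟩ := exists_equiv_semiconj_shiftPerm hg
  have := Fintype.ofFinite (Quotient (SameCycle.setoid g))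
  have hconj : e.permCongr g = shiftPerm _ d := Equiv.ext fun p => by
    rw [Equiv.permCongr_apply, he, e.apply_symm_apply]
  obtain ⟨D, rfl⟩ := Nat.exists_eq_succ_of_ne_zero (NeZero.ne d)
  have hrotate : sign (Equiv.addRight (1 : ZMod (D + 1))) = (-1) ^ D :=
    (congrArg sign (Equiv.ext fun x => (finRotate_apply x).symm)).trans (sign_finRotate (D + 1))
  rw [← sign_permCongr e, hconj, shiftPerm, sign_prodCongrRight, Finset.prod_const, hrotate,
    ← pow_mul, Finset.card_univ, ← Nat.card_eq_fintype_card,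
    ← card_quotient_sameCycle_mul hg,
    Nat.mul_div_cancel _ D.succ_pos, Nat.mul_succ, add_assoc, ← two_mul, pow_add, pow_mul (-1) 2]
  simp [mul_comm]

end EquivariantMaps

section TransitivePartitions

open Function Equiv.Perm Polynomial

variable {α β : Type*} {R : Type*} {g : Equiv.Perm α}

/-- The set partitions of `α` invariant under the permutation `g`, ordered by refinement. They are
the fixed points of `g` in the partition lattice, whose Möbius number is the character at `g` of the
homology, up to sign. -/
abbrev InvariantSetoid (g : Equiv.Perm α) : Type _ :=
  {r : Setoid α // ∀ x y, r (g x) (g y) ↔ r x y}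

instance instBoundedOrderInvariantSetoid : BoundedOrder (InvariantSetoid g) where
  bot := ⟨⊥, fun _ _ => g.injective.eq_iff⟩
  bot_le _ := bot_le (α := Setoid α)
  top := ⟨⊤, fun _ _ => Iff.rfl⟩
  le_top _ := le_top (α := Setoid α)

/- Möbius inversion: a map equivariant for `g` has an invariant kernel, and it is injective if and
only if this kernel is `⊥`. -/
theorem sum_mu_mul_card_semiconj [Finite α] [Finite β] [Ring R] [Fintype (InvariantSetoid g)]
    [LocallyFiniteOrder (InvariantSetoid g)] [DecidableEq (InvariantSetoid g)]
    (h : Equiv.Perm β) :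
    ∑ r : InvariantSetoid g, IncidenceAlgebra.mu R ⊥ r *
      (Nat.card {f : α → β // Semiconj f g h ∧ r.1 ≤ Setoid.ker f} : R) =
      Nat.card {f : α → β // Semiconj f g h ∧ Injective f} := by
  classical
  have := Fintype.ofFinite (α → β)
  let ker (f : {f : α → β // Semiconj f g h}) : InvariantSetoid g :=
    ⟨Setoid.ker f.1, fun x y => by
      rw [Setoid.ker_def, Setoid.ker_def, f.2.eq, f.2.eq, h.injective.eq_iff]⟩
  have hker : ∀ f, ⊥ = ker f ↔ Injective f.1 := fun f => by
    rw [← Setoid.ker_eq_bot_iff, eq_comm, Subtype.ext_iff]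
    rfl
  have hcount : ∀ p : (α → β) → Prop, (Nat.card {f : α → β // Semiconj f g h ∧ p f} : R) =
      ∑ f : {f : α → β // Semiconj f g h}, if p f.1 then 1 else 0 := fun p => by
    rw [Finset.sum_boole, ← Fintype.card_subtype, ← Nat.card_eq_fintype_card,
      Nat.card_congr (Equiv.subtypeSubtypeEquivSubtypeInter _ _)]
  simp only [hcount, Finset.mul_sum, mul_ite, mul_one, mul_zero]
  rw [Finset.sum_comm]
  refine Finset.sum_congr rfl fun f _ => ?_
  rw [← Finset.sum_filter, ← if_congr (hker f) rfl rfl, ← IncidenceAlgebra.sum_Icc_mu_right]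
  refine Finset.sum_congr (Finset.ext fun r => ?_) fun _ _ => rfl
  rw [Finset.mem_filter_univ, Finset.mem_Icc, and_iff_right bot_le]
  rfl

theorem card_semiconj_prodCongrRight [Finite α] (Q : Type*) (h : Equiv.Perm β) (r : Setoid α) :
    Nat.card {f : α → Q × β // Semiconj f g (Equiv.prodCongrRight fun _ => h) ∧
      r ≤ Setoid.ker f} =
      Nat.card {f : α → β // Semiconj f g h ∧ r ≤ Setoid.ker f} *
        Nat.card Q ^ Nat.card (Quotient (r ⊔ SameCycle.setoid g)) := by
  rw [← Nat.card_fun, ← Nat.card_congr (Setoid.liftEquiv _), ← Nat.card_prod]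
  refine Nat.card_congr
    { toFun := fun f => (⟨fun x => (f.1 x).2, fun x => congrArg Prod.snd (f.2.1 x),
          fun _ _ hxy => congrArg Prod.snd (f.2.2 hxy)⟩,
        ⟨fun x => (f.1 x).1, sup_le (fun _ _ hxy => congrArg Prod.fst (f.2.2 hxy))
          (sameCycle_setoid_le_ker_iff.2 fun x => (congrArg Prod.fst (f.2.1 x) :))⟩)
      invFun := fun p => ⟨fun x => (p.2.1 x, p.1.1 x), fun x => Prod.ext
          (sameCycle_setoid_le_ker_iff.1 (le_sup_right.trans p.2.2) x) (p.1.2.1 x),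
        fun _ _ hxy => Prod.ext ((le_sup_left.trans p.2.2) hxy) (p.1.2.2 hxy)⟩
      left_inv := fun _ => rfl
      right_inv := fun _ => rfl }

theorem eval_descPochhammer_neg_one [CommRing R] (k : ℕ) :
    (descPochhammer R k).eval (-1) = (-1) ^ k * k.factorial := by
  have hasc := ascPochhammer_eval_neg_eq_descPochhammer R (-1) k
  rw [neg_neg, ascPochhammer_eval_one] at hasc
  rw [hasc, ← mul_assoc, ← mul_pow, neg_one_mul, neg_neg, one_pow, one_mul]

/- Both sides are polynomials in `q`; compare the coefficients of `q`. -/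
theorem sum_filter_eq_one_of_sum_mul_pow_eq_descFactorial [CommRing R] [IsDomain R] [CharZero R]
    {ι : Type*} [Fintype ι] {v : ι → R} {e : ι → ℕ} {c : R} {m : ℕ} (hm : m ≠ 0)
    (h : ∀ q : ℕ, ∑ i, v i * (q : R) ^ e i = c * ((q * m).descFactorial m : ℕ)) :
    ∑ i with e i = 1, v i = (-1) ^ (m + 1) * (c * m.factorial) := by
  obtain ⟨k, rfl⟩ := Nat.exists_eq_succ_of_ne_zero hm
  have hpoly : (∑ i, C (v i) * X ^ e i : R[X]) =
      C c * (descPochhammer R (k + 1)).comp (X * C ((k + 1 : ℕ) : R)) := by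
    refine eq_of_infinite_eval_eq _ _
      ((Set.infinite_range_of_injective (Nat.cast_injective (R := R))).mono ?_)
    rintro _ ⟨q, rfl⟩
    simp only [Set.mem_ofPred_eq, eval_finsetSum, eval_mul, eval_C, eval_pow, eval_X, eval_comp]
    rw [h q, ← Nat.cast_mul, descPochhammer_eval_eq_descFactorial]
  have hcoeff := congrArg (fun p : R[X] => p.coeff (0 + 1)) hpoly
  simp only [finsetSum_coeff, coeff_C_mul, coeff_X_pow, descPochhammer_succ_left, mul_comp,
    X_comp, mul_assoc, coeff_X_mul, coeff_zero_eq_eval_zero, eval_mul, eval_comp, eval_sub,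
    eval_X, eval_C, eval_one, zero_mul, zero_sub, eval_descPochhammer_neg_one, zero_add, mul_ite,
    mul_one, mul_zero, eq_comm (a := 1)] at hcoeff
  rw [Finset.sum_filter, hcoeff, Nat.factorial_succ]
  rw [Nat.succ_eq_add_one, pow_add _ (k + 1), pow_succ]
  push_cast
  ring

variable [CommRing R] [IsDomain R] [CharZero R] [Fintype (InvariantSetoid g)]
  [LocallyFiniteOrder (InvariantSetoid g)] [DecidableEq (InvariantSetoid g)]

/- The maps to `Fin q × β` that are constant on the blocks of `r` number `q ^ k` times those to `β`,
where `k` is the number of blocks of `r ⊔ SameCycle.setoid g`; so the coefficient of `q` picks out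
the partitions whose blocks are permuted transitively by `g`. -/
open Classical in
theorem sum_mu_mul_card_semiconj_of_sup_sameCycle_eq_top [Finite α] [Nonempty α] [Finite β]
    {h : Equiv.Perm β} {m : ℕ} (hm : m ≠ 0) {c : R}
    (hcount : ∀ q : ℕ, (Nat.card {f : α → Fin q × β //
      Semiconj f g (Equiv.prodCongrRight fun _ => h) ∧ Injective f} : R) =
        c * ((q * m).descFactorial m : ℕ)) :
    ∑ r : InvariantSetoid g with r.1 ⊔ SameCycle.setoid g = ⊤, IncidenceAlgebra.mu R ⊥ r *
      (Nat.card {f : α → β // Semiconj f g h ∧ r.1 ≤ Setoid.ker f} : R) =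
      (-1) ^ (m + 1) * (c * m.factorial) := by
  have htop : ∀ s : Setoid α, s = ⊤ ↔ Nat.card (Quotient s) = 1 := fun s => by
    rw [← Quotient.subsingleton_iff, Nat.card_eq_one_iff_unique,
      and_iff_left (Nonempty.map (Quotient.mk s) ‹_›)]
  simp only [htop]
  refine sum_filter_eq_one_of_sum_mul_pow_eq_descFactorial hm fun q => ?_
  rw [← hcount q, ← sum_mu_mul_card_semiconj]
  simp only [card_semiconj_prodCongrRight, Nat.card_fin, Nat.cast_mul, Nat.cast_pow, mul_assoc]

open Classical in
theorem sum_mu_mul_card_semiconj_eq_sign_mul [Fintype α] [DecidableEq α] [Nonempty α]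
    [Finite β] {h : Equiv.Perm β} {d : ℕ} [NeZero d] (hh : ∀ y, minimalPeriod h y = d)
    (hcard : Nat.card α = Nat.card β) :
    ∑ r : InvariantSetoid g with r.1 ⊔ SameCycle.setoid g = ⊤, IncidenceAlgebra.mu R ⊥ r *
      (Nat.card {f : α → β // Semiconj f g h ∧ r.1 ≤ Setoid.ker f} : R) =
      (-1) ^ (Nat.card α + 1) * (sign g : ℤ) *
        Nat.card {f : α → β // Semiconj f g h ∧ Injective f} := by
  by_cases hex : ∃ (q : ℕ) (f : α → Fin q × β),
    Semiconj f g (Equiv.prodCongrRight fun _ => h) ∧ Injective f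
  · have hh' : ∀ q (p : Fin q × β), minimalPeriod (Equiv.prodCongrRight fun _ => h) p = d :=
      fun q p => (minimalPeriod_prodMap id h p).trans (by simp [hh])
    obtain ⟨q, f, hf, hinj⟩ := hex
    have hg : ∀ x, minimalPeriod g x = d := fun x =>
      (minimalPeriod_eq_of_semiconj hinj hf x).trans (hh' q _)
    have hdvd : d ∣ Nat.card α := Dvd.intro_left _ (card_quotient_sameCycle_mul hg)
    have hm : Nat.card α / d ≠ 0 :=
      (Nat.div_pos (Nat.le_of_dvd Nat.card_pos hdvd) (NeZero.pos d)).ne'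
    have hsign : (-1 : R) ^ (Nat.card α + 1) * (sign g : ℤ) = (-1) ^ (Nat.card α / d + 1) := by
      rw [sign_eq_of_minimalPeriod_eq hg]
      push_cast
      rw [← pow_add, add_add_add_comm, ← two_mul, pow_add, pow_mul, neg_one_sq, one_pow, one_mul,
        add_comm]
    rw [sum_mu_mul_card_semiconj_of_sup_sameCycle_eq_top hm (c := (d : R) ^ (Nat.card α / d)),
      card_injective_semiconj hg hh, hsign, ← hcard, Nat.descFactorial_self, Nat.cast_mul,
      Nat.cast_pow]
    · intro q
      rw [card_injective_semiconj hg (hh' q), Nat.card_prod, Nat.card_fin, ← hcard,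
        Nat.mul_div_assoc _ hdvd, Nat.cast_mul, Nat.cast_pow]
  · have hempty : IsEmpty {f : α → β // Semiconj f g h ∧ Injective f} :=
      ⟨fun f => hex ⟨1, fun x => (0, f.1 x), fun x => Prod.ext rfl (f.2.1 x),
        fun _ _ hxy => f.2.2 (congrArg Prod.snd hxy)⟩⟩
    rw [sum_mu_mul_card_semiconj_of_sup_sameCycle_eq_top one_ne_zero (c := 0),
      Nat.card_of_isEmpty (α := {f : α → β // _})]
    · simp
    · intro q
      have : IsEmpty {f : α → Fin q × β //
        Semiconj f g (Equiv.prodCongrRight fun _ => h) ∧ Injective f} :=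
        ⟨fun f => hex ⟨q, f.1, f.2⟩⟩
      rw [Nat.card_of_isEmpty, Nat.cast_zero, zero_mul]

end TransitivePartitions

section CyclicSum

open Function Equiv.Perm

variable {α : Type*} {g : Equiv.Perm α}

theorem card_dvd_card_of_semiconj {β : Type*} [Finite α] [Finite β] {f : α → β}
    {b : Equiv.Perm β} (hf : Semiconj f g b) (hb : ∀ y z, b.SameCycle y z) :
    Nat.card β ∣ Nat.card α := by
  rcases isEmpty_or_nonempty β with _ | ⟨⟨y⟩⟩
  · have : IsEmpty α := f.isEmpty
    simp
  have hfibre : ∀ z, Nat.card {x // f x = z} = Nat.card {x // f x = y} := fun z => by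
    obtain ⟨i, rfl⟩ := hb y z
    exact (Nat.card_congr ((g ^ i).subtypeEquiv fun x => by
      rw [(semiconj_zpow hf i).eq, EmbeddingLike.apply_eq_iff_eq])).symm
  have := Fintype.ofFinite β
  refine ⟨Nat.card {x // f x = y}, ?_⟩
  rw [← Nat.card_congr (Equiv.sigmaFiberEquiv f), Nat.card_sigma, Finset.sum_congr rfl
    fun z _ => hfibre z, Finset.sum_const, Finset.card_univ, smul_eq_mul,
    ← Nat.card_eq_fintype_card]

theorem minimalPeriod_mulLeft {C : Type*} [Group C] (h x : C) :
    minimalPeriod (Equiv.mulLeft h) x = orderOf h := by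
  have hx := minimalPeriod_eq_of_semiconj (mul_left_injective x) (g := (h * ·))
    (h := Equiv.mulLeft h) (fun y => mul_assoc h y x) 1
  rw [← one_mul x]
  exact hx.symm

variable {C : Type*} [CommGroup C] {R : Type*} [CommRing R] [IsDomain R]

theorem card_semiconj_mulLeft_mul {r : Setoid α} {a : α → C} {k : C}
    (ha : Semiconj a g (Equiv.mulLeft k)) (har : r ≤ Setoid.ker a) (h : C) :
    Nat.card {f : α → C // Semiconj f g (Equiv.mulLeft (h * k)) ∧ r ≤ Setoid.ker f} =
      Nat.card {f : α → C // Semiconj f g (Equiv.mulLeft h) ∧ r ≤ Setoid.ker f} := by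
  refine (Nat.card_congr ((Equiv.mulRight a).subtypeEquiv fun f => and_congr ?_ ?_)).symm
  · refine forall_congr' fun x => ?_
    change _ ↔ f (g x) * a (g x) = h * k * (f x * a x)
    rw [ha x, Equiv.coe_mulLeft, Equiv.coe_mulLeft, mul_mul_mul_comm h, mul_left_inj]
  · refine forall₃_congr fun x y hxy => ?_
    change f x = f y ↔ f x * a x = f y * a y
    rw [show a x = a y from har hxy, mul_left_inj]

/-- The permutation of the blocks of a `g`-invariant partition induced by `g`. -/
def blockPerm (r : InvariantSetoid g) : Equiv.Perm (Quotient r.1) :=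
  Quotient.congr g fun x y => (r.2 x y).symm

theorem semiconj_mk_blockPerm (r : InvariantSetoid g) :
    Semiconj (Quotient.mk r.1) g (blockPerm r) :=
  fun _ => rfl

theorem sameCycle_blockPerm {r : InvariantSetoid g} (hr : r.1 ⊔ SameCycle.setoid g = ⊤)
    (y z : Quotient r.1) : (blockPerm r).SameCycle y z := by
  have hle : r.1 ⊔ SameCycle.setoid g ≤
      (SameCycle.setoid (blockPerm r)).comap (Quotient.mk r.1) := by
    refine sup_le (fun x y hxy => ?_) fun x y ⟨i, hi⟩ => ⟨i, ?_⟩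
    · exact ⟨0, Quotient.sound hxy⟩
    · rw [← (semiconj_zpow (semiconj_mk_blockPerm r) i).eq, hi]
  induction y, z using Quotient.inductionOn₂ with
  | h x y => exact hle (hr ▸ trivial : (r.1 ⊔ SameCycle.setoid g) x y)

theorem exists_ne_one_semiconj_mulLeft [Finite α] [Finite C] (hcard : Nat.card C = Nat.card α)
    {r : InvariantSetoid g} (hr : r.1 ⊔ SameCycle.setoid g = ⊤) (hr' : r ≠ ⊤) :
    ∃ k : C, k ≠ 1 ∧ ∃ a : α → C, Semiconj a g (Equiv.mulLeft k) ∧ r.1 ≤ Setoid.ker a := by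
  have := Fintype.ofFinite (Quotient r.1)
  have hcycle : (blockPerm r).IsCycleOn (Finset.univ : Finset (Quotient r.1)) := by
    rw [Finset.coe_univ]
    exact ⟨Set.bijOn_univ.2 (blockPerm r).bijective, fun y _ z _ => sameCycle_blockPerm hr y z⟩
  have hne : Nat.card (Quotient r.1) ≠ 1 := fun h => hr' <| Subtype.ext <|
    Quotient.subsingleton_iff.1 (Nat.card_eq_one_iff_unique.1 h).1
  obtain ⟨p, hp, hpdvd⟩ := Nat.exists_prime_and_dvd hne
  have := Fact.mk hp
  obtain ⟨k, hk⟩ := exists_prime_orderOf_dvd_card' (G := C) p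
    (hcard ▸ hpdvd.trans (card_dvd_card_of_semiconj (semiconj_mk_blockPerm r)
      (sameCycle_blockPerm hr)))
  refine ⟨k, fun h => hp.one_lt.ne' (hk ▸ h ▸ orderOf_one), ?_⟩
  obtain ⟨a, ha⟩ := exists_semiconj_mul_left (g := blockPerm r) (h := k) fun B i hi => by
    rw [hcycle.zpow_apply_eq (Finset.mem_univ B), Finset.card_univ,
      ← Nat.card_eq_fintype_card] at hi
    exact orderOf_dvd_iff_zpow_eq_one.1 ((hk ▸ Int.natCast_dvd_natCast.2 hpdvd).trans hi)
  exact ⟨fun x => a (Quotient.mk r.1 x), fun x => ha (Quotient.mk r.1 x),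
    fun x y hxy => congrArg a (Quotient.sound hxy)⟩

theorem card_semiconj_mulLeft_top [Nonempty α] [DecidableEq C] (h : C) :
    Nat.card {f : α → C // Semiconj f g (Equiv.mulLeft h) ∧ ⊤ ≤ Setoid.ker f} =
      if h = 1 then Nat.card C else 0 := by
  obtain ⟨x₀⟩ := ‹Nonempty α›
  split_ifs with hh
  · subst hh
    refine Nat.card_congr
      { toFun := fun f => f.1 x₀
        invFun := fun c => ⟨fun _ => c, fun _ => (one_mul c).symm, fun _ _ _ => rfl⟩
        left_inv := fun f => Subtype.ext (funext fun x => f.2.2 (x := x₀) (y := x) trivial)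
        right_inv := fun c => rfl }
  · have : IsEmpty {f : α → C // Semiconj f g (Equiv.mulLeft h) ∧ ⊤ ≤ Setoid.ker f} :=
      ⟨fun f => hh <| right_eq_mul.1 <|
        (f.2.2 (x := x₀) (y := g x₀) trivial : f.1 x₀ = f.1 (g x₀)).trans (f.2.1 x₀)⟩
    exact Nat.card_of_isEmpty

variable [Fintype C] {χ : C →* R} (hχ : Injective χ)

/- Multiplication by a map equivariant for some `k ≠ 1` shifts the summation index by `k`, so the
sum equals `χ k` times itself. -/
include hχ in
theorem sum_character_mul_card_semiconj_eq_zero [Finite α] (hcard : Nat.card C = Nat.card α)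
    {r : InvariantSetoid g} (hr : r.1 ⊔ SameCycle.setoid g = ⊤) (hr' : r ≠ ⊤) :
    ∑ h : C, χ h *
      (Nat.card {f : α → C // Semiconj f g (Equiv.mulLeft h) ∧ r.1 ≤ Setoid.ker f} : R) = 0 := by
  obtain ⟨k, hk, a, ha, har⟩ := exists_ne_one_semiconj_mulLeft hcard hr hr'
  refine eq_zero_of_mul_eq_self_left (mt (hχ.eq_iff' χ.map_one).1 hk) ?_
  rw [Finset.mul_sum]
  refine Fintype.sum_equiv (Equiv.mulRight k) _ _ fun h => ?_
  rw [Equiv.coe_mulRight, card_semiconj_mulLeft_mul ha har, map_mul,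
    mul_comm (χ h) (χ k), mul_assoc]

variable [CharZero R] [LocallyFiniteOrder (InvariantSetoid g)]
  [DecidableEq (InvariantSetoid g)]

include hχ in
theorem card_mul_mu_bot_top [Fintype α] [DecidableEq α] [Nonempty α]
    (hcard : Nat.card C = Nat.card α) :
    Nat.card C * IncidenceAlgebra.mu R (⊥ : InvariantSetoid g) ⊤ =
      (-1) ^ (Nat.card α + 1) * (sign g : ℤ) * ∑ h : C, χ h *
        Nat.card {f : α → C // Semiconj f g (Equiv.mulLeft h) ∧ Injective f} := by
  classical
  have := Fintype.ofFinite (InvariantSetoid g)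
  have hsum : ∀ h : C, (-1) ^ (Nat.card α + 1) * ((sign g : ℤ) : R) * (χ h *
      Nat.card {f : α → C // Semiconj f g (Equiv.mulLeft h) ∧ Injective f}) =
      ∑ r : InvariantSetoid g with r.1 ⊔ SameCycle.setoid g = ⊤, IncidenceAlgebra.mu R ⊥ r *
        (χ h * Nat.card {f : α → C // Semiconj f g (Equiv.mulLeft h) ∧
          r.1 ≤ Setoid.ker f}) := fun h => by
    have : NeZero (orderOf h) := ⟨(orderOf_pos h).ne'⟩
    rw [mul_left_comm, ← sum_mu_mul_card_semiconj_eq_sign_mul (minimalPeriod_mulLeft h) hcard.symm,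
      Finset.mul_sum]
    exact Finset.sum_congr rfl fun r _ => mul_left_comm _ _ _
  have htop : ∑ h : C, χ h * (Nat.card {f : α → C // Semiconj f g (Equiv.mulLeft h) ∧
      ⊤ ≤ Setoid.ker f} : R) = Nat.card C := by
    simp only [card_semiconj_mulLeft_top, Nat.cast_ite, Nat.cast_zero, mul_ite, mul_zero,
      Finset.sum_ite_eq', Finset.mem_univ, if_true, map_one, one_mul]
  rw [Finset.mul_sum, Finset.sum_congr rfl fun h _ => hsum h, Finset.sum_comm,
    Finset.sum_eq_single_of_mem ⊤
      ((Finset.mem_filter_univ (⊤ : InvariantSetoid g)).2 (top_sup_eq _))]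
  · rw [← Finset.mul_sum, mul_comm]
    exact congrArg _ htop.symm
  · intro r hr hr'
    rw [← Finset.mul_sum, sum_character_mul_card_semiconj_eq_zero hχ hcard
      ((Finset.mem_filter_univ r).1 hr) hr', mul_zero]

end CyclicSum

section PartitionHomology

open Function Equiv.Perm
open scoped IsMulCommutative

theorem card_conj_eq_card_injective_semiconj {α β : Type*} [Finite α] {g k : Equiv.Perm α}
    {h : Equiv.Perm β} (e : β ≃ α) (he : Semiconj e h k) :
    Nat.card {x : Equiv.Perm α // x * g * x⁻¹ = k} =
      Nat.card {f : α → β // Semiconj f g h ∧ Injective f} := by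
  have hiff : ∀ x : Equiv.Perm α, x * g * x⁻¹ = k ↔ Semiconj (e.symm ∘ x) g h := fun x => by
    rw [mul_inv_eq_iff_eq_mul, Equiv.ext_iff]
    refine forall_congr' fun y => ?_
    rw [comp_apply, comp_apply, e.symm_apply_eq, he.eq, e.apply_symm_apply]
    rfl
  have hbij : ∀ f : α → β, Injective f → Bijective (e ∘ f) := fun f hf =>
    Finite.injective_iff_bijective.1 (e.injective.comp hf)
  exact Nat.card_congr
    { toFun := fun x => ⟨e.symm ∘ x.1, (hiff x.1).1 x.2, e.symm.injective.comp x.1.injective⟩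
      invFun := fun f => ⟨Equiv.ofBijective _ (hbij f.1 f.2.2), (hiff _).2 <| by
        convert! f.2.1
        exact funext fun y => e.symm_apply_apply _⟩
      left_inv := fun x => Subtype.ext (Equiv.ext fun y => e.apply_symm_apply _)
      right_inv := fun f => Subtype.ext (funext fun y => e.symm_apply_apply _) }

theorem partitionAction_eq_self_iff {n : ℕ} {g : Equiv.Perm (Fin n)} {r : Setoid (Fin n)} :
    partitionAction n g r = r ↔ ∀ x y, r (g x) (g y) ↔ r x y :=
  eq_comm.trans <| (partitionAction n g).symm_apply_eq.symm.trans Setoid.ext_iff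

variable {n : ℕ} [NeZero n]

theorem apply_eq_apply_zero_add (c : cyclicSubgroup n) (y : Fin n) : c.1 y = c.1 0 + y := by
  obtain ⟨_, i, rfl⟩ := c
  have hsemi : Semiconj (· + y) (finRotate n) (finRotate n) := fun x => by
    simp only [finRotate_apply, add_right_comm]
  simpa only [zero_add] using ((semiconj_zpow hsemi i) 0).symm

theorem bijective_apply_zero : Bijective fun c : cyclicSubgroup n => c.1 0 := by
  refine ⟨fun c c' h => Subtype.ext (Equiv.ext fun y => ?_), fun j => ?_⟩
  · rw [apply_eq_apply_zero_add, apply_eq_apply_zero_add c', show c.1 0 = c'.1 0 from h]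
  · have hpow : (finRotate n ^ (j : ℕ)) 0 = j := by
      rw [coe_pow, ← finCycle_eq_finRotate_iterate, finCycle_apply, zero_add]
    exact ⟨cyclicGenerator n ^ (j : ℕ), hpow⟩

theorem card_cyclicSubgroup : Nat.card (cyclicSubgroup n) = n :=
  (Nat.card_eq_of_bijective _ bijective_apply_zero).trans (Nat.card_fin n)

theorem injective_cyclicCharacter : Injective (cyclicCharacter n) := by
  refine (injective_iff_map_eq_one _).2 fun c hc => ?_
  obtain ⟨i, rfl⟩ := mem_zpowers_cyclicGenerator n c
  have hroot : Complex.exp (2 * Real.pi * Complex.I / n) ^ i = 1 := by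
    rw [← cyclicCharacter_cyclicGenerator, ← Units.val_zpow_eq_zpow_val, ← map_zpow, hc,
      Units.val_one]
  have hdvd := ((Complex.isPrimitiveRoot_exp n (NeZero.ne n)).zpow_eq_one_iff_dvd i).1 hroot
  refine orderOf_dvd_iff_zpow_eq_one.1 (dvd_trans (Int.natCast_dvd_natCast.2 ?_) hdvd)
  exact (orderOf_dvd_natCard _).trans card_cyclicSubgroup.dvd

variable (g : Equiv.Perm (Fin n))

theorem natCast_mul_character_lieRep [Fintype (cyclicSubgroup n)] :
    n * (lieRep n).character g = ∑ h, (Units.coeHom ℂ).comp (cyclicCharacter n) h *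
      Nat.card {f : Fin n → cyclicSubgroup n // Semiconj f g (Equiv.mulLeft h) ∧ Injective f} := by
  let e := Equiv.ofBijective _ (bijective_apply_zero (n := n))
  rw [lieRep, character_ind_linearCharacterRep, ← Nat.card_eq_fintype_card, card_cyclicSubgroup,
    mul_inv_cancel_left₀ (NeZero.ne (n : ℂ))]
  refine Finset.sum_congr rfl fun h _ => ?_
  rw [card_conj_eq_card_injective_semiconj (k := h.1) (h := Equiv.mulLeft h) e fun c => rfl,
    mul_comm]
  rfl

variable [LocallyFiniteOrder (InvariantSetoid g)] [DecidableEq (InvariantSetoid g)]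

theorem character_lieRep_tprod_signRep :
    ((lieRep n).tprod (signRep n)).character g =
      (-1) ^ (n + 1) * IncidenceAlgebra.mu ℂ (⊥ : InvariantSetoid g) ⊤ := by
  have : Module.Finite ℂ (MonoidAlgebra ℂ (Equiv.Perm (Fin n))) :=
    Module.Finite.equiv (MonoidAlgebra.coeffLinearEquiv ℂ).symm
  have := Fintype.ofFinite (cyclicSubgroup n)
  have hmu := card_mul_mu_bot_top (g := g) (χ := (Units.coeHom ℂ).comp (cyclicCharacter n))
    (Units.val_injective.comp injective_cyclicCharacter)
    (card_cyclicSubgroup.trans (Nat.card_fin n).symm)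
  rw [← natCast_mul_character_lieRep, card_cyclicSubgroup, Nat.card_fin] at hmu
  have hsign : (signRep n).character g = (sign g : ℤ) := trace_linearCharacterRep _ g
  have hsq : (-1 : ℂ) ^ (n + 1) * (-1) ^ (n + 1) = 1 := by rw [← mul_pow]; simp
  rw [Representation.char_tensor, Pi.mul_apply, hsign]
  refine mul_left_cancel₀ (NeZero.ne (n : ℂ)) ?_
  linear_combination -(-1) ^ (n + 1) * hmu - (sign g : ℤ) * n * (lieRep n).character g * hsq

theorem character_properPartHomology_partitionAction :
    (properPartHomology (partitionAction n) (n - 3)).ρ.character g =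
      (-1) ^ (n + 1) * IncidenceAlgebra.mu ℂ (⊥ : InvariantSetoid g) ⊤ := by
  obtain ⟨m, hm⟩ := Nat.exists_eq_succ_of_ne_zero (NeZero.ne n)
  have htop : partitionRank (⊤ : Setoid (Fin n)) = m := by
    rw [partitionRank_top, Nat.card_fin, hm, Nat.succ_sub_one]
  have hdegree : (n - 3 : ℤ) = m - (0 : ℕ) - 2 := by omega
  have hsign : (-1 : ℂ) ^ (n + 1) = (-1) ^ (m - 0) := by
    rw [hm, Nat.sub_zero, Nat.succ_eq_add_one, add_assoc, pow_add, neg_one_sq, mul_one]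
  rw [hdegree, hsign, ← htop, ← partitionRank_bot (α := Fin n)]
  exact character_properPartHomology (fun _ _ => partitionRank_le_of_covBy)
    partitionRank_strictMono (partitionAction n) g (OrderEmbedding.subtype _)
    fun r => Subtype.range_coe_subtype ▸ partitionAction_eq_self_iff.symm

end PartitionHomology

theorem theorem3 (n : ℕ) (hn : 1 ≤ n) :
    Nonempty (properPartHomology (partitionAction n) ((n : ℤ) - 3) ≅
      Rep.of ((lieRep n).tprod (signRep n))) := by
  classical
  have : NeZero n := ⟨Nat.one_le_iff_ne_zero.1 hn⟩
  have := finiteDimensional_properPartHomology (partitionAction n) (n - 3)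
  have : Module.Finite ℂ (MonoidAlgebra ℂ (Equiv.Perm (Fin n))) :=
    Module.Finite.equiv (MonoidAlgebra.coeffLinearEquiv ℂ).symm
  refine nonempty_iso_of_character_eq (funext fun g => ?_)
  have := Fintype.ofFinite (InvariantSetoid g)
  have : LocallyFiniteOrder (InvariantSetoid g) := Fintype.toLocallyFiniteOrder
  exact (character_properPartHomology_partitionAction g).trans
    (character_lieRep_tprod_signRep g).symm
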